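/- Let $\mathcal H$ be a finite-dimensional complex Hilbert space, let $T,\alpha,\zeta>0$, put $\omega=2\pi/T$ and $\mathrm{BZ}=[-\omega/2,\omega/2)$, and consider a Hermitian time-periodic Hamiltonian with exponentially decaying Fourier components, $$H(t)=\sum_{m\in\mathbb Z}H_m e^{-im\omega t},\qquad \|H_m\|\le \alpha e^{-|m|/\zeta}\quad(m\in\mathbb Z).$$ A Floquet eigenstate with quasienergy $\epsilon\in\mathbb R$ is a $T$-periodic family of unit vectors $\phi(t)\in\mathcal H$ such that $\psi(t)=e^{-i\epsilon t}\phi(t)$ solves $i\psi'(t)=H(t)\psi(t)$; its Fourier components are $\phi^l=\frac1T\int_0^T e^{il\omega t}\phi(t)\,dt$, so that $\phi(t)=\sum_{l\in\mathbb Z}e^{-il\omega t}\phi^l$. For $L\in\mathbb N$ let $[L]=\{-L+1,\dots,L\}$ and let $H_F^L$ be the truncated Floquet Hamiltonian on $\mathbb C^{[L]}\otimes\mathcal H$, $$H_F^L=\sum_{l,l'\in[L]}|l\rangle\langle l'|\otimes H_{l-l'}-\sum_{l\in[L]}l\omega\,|l\rangle\langle l|\otimes I .$$ (i) (Tails of Floquet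 eigenstates.) If $\phi$ is a Floquet eigenstate with quasienergy $\epsilon\in\mathrm{BZ}$, then for every $l\in\mathbb Z$ $$\|\phi^l\|\le\exp\left(-\frac{|l|-1/2}{4\zeta}+\frac{\coth(1/(4\zeta))}{8\pi\zeta}\,\alpha T\right).$$ (ii) (Accuracy of quasienergy.) There is a constant $C>0$ depending only on $\zeta$ such that for every $\delta\in(0,1)$ and every cutoff $L\in\mathbb N$ with $L\ge C(\alpha T+\log(1/\delta))$: for every quasienergy $\epsilon\in\mathrm{BZ}$ of $H$ there is an eigenvalue $\tilde\epsilon$ of $H_F^L$ with $|\tilde\epsilon-\epsilon|/\omega\le\delta$; and conversely, for every eigenvalue $\tilde\epsilon\in[-\omega,\omega)$ of $H_F^L$ there is a quasienergy $\epsilon\in\mathrm{BZ}$ of $H$ with $\left|\left(\frac{\epsilon-\tilde\epsilon}{\omega}\right)\bmod 1\right|\le\delta$, where the residue modulo $1$ is taken in $[-1/2,1/2)$. -/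

import Mathlib

noncomputable section

namespace Floquet

/-- The angular frequency `ω = 2π / T` belonging to the period `T`. -/
def freq (T : ℝ) : ℝ := 2 * Real.pi / T

/-- The Brillouin zone `[-ω/2, ω/2)`. -/
def brillouinZone (T : ℝ) : Set ℝ := Set.Ico (-(freq T / 2)) (freq T / 2)

/-- The hyperbolic cotangent. -/
def coth (x : ℝ) : ℝ := Real.cosh x / Real.sinh x

/-- The representative of `x` modulo `1` that lies in `[-1/2, 1/2)`. -/
def modOne (x : ℝ) : ℝ := toIcoMod (zero_lt_one : (0 : ℝ) < 1) (-(1 / 2)) x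

section

variable {E : Type*} [NormedAddCommGroup E] [InnerProductSpace ℂ E]

/-- `H` is a Hermitian time-dependent Hamiltonian `H(t) = ∑ₘ Hₘ e^{-imωt}`, `ω = 2π / T`, whose
Fourier components satisfy `‖Hₘ‖ ≤ α e^{-|m|/ζ}` in operator norm. -/
structure IsExpDecayHamiltonian (T α ζ : ℝ) (H : ℝ → E →L[ℂ] E) (Hm : ℤ → E →L[ℂ] E) : Prop where
  hermitian : ∀ t : ℝ, ((H t : E →L[ℂ] E) : E →ₗ[ℂ] E).IsSymmetric
  hasSum : ∀ t : ℝ,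
    HasSum (fun m : ℤ => Complex.exp (-(Complex.I * (m * freq T * t : ℝ))) • Hm m) (H t)
  norm_le : ∀ m : ℤ, ‖Hm m‖ ≤ α * Real.exp (-|(m : ℝ)| / ζ)

/-- `φ` is a (normalized) Floquet eigenstate with quasienergy `ε` of the `T`-periodic Hamiltonian
`H`: it is `T`-periodic and `ψ(t) = e^{-iεt} φ(t)` solves `i ψ'(t) = H(t) ψ(t)`. -/
structure IsFloquetEigenstate (T : ℝ) (H : ℝ → E →L[ℂ] E) (ε : ℝ) (φ : ℝ → E) : Prop where
  periodic : ∀ t : ℝ, φ (t + T) = φ t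
  norm_eq_one : ∀ t : ℝ, ‖φ t‖ = 1
  schrodinger : ∀ t : ℝ,
    HasDerivAt (fun s : ℝ => Complex.exp (-(Complex.I * (ε * s : ℝ))) • φ s)
      (-(Complex.I • H t (Complex.exp (-(Complex.I * (ε * t : ℝ))) • φ t))) t

/-- `ε` is a quasienergy of `H`. -/
def IsQuasienergy (T : ℝ) (H : ℝ → E →L[ℂ] E) (ε : ℝ) : Prop :=
  ∃ φ : ℝ → E, IsFloquetEigenstate T H ε φ

/-- The `l`-th Fourier component `φ^l = T⁻¹ ∫₀ᵀ e^{ilωt} φ(t) dt` of a `T`-periodic function, in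
the convention `φ(t) = ∑ₗ e^{-ilωt} φ^l`. -/
def fourierComponent (T : ℝ) (φ : ℝ → E) (l : ℤ) : E :=
  (T⁻¹ : ℝ) • ∫ t in (0 : ℝ)..T, Complex.exp (Complex.I * (l * freq T * t : ℝ)) • φ t

/-- The Fourier indices `[L] = {-L+1, …, L}` kept by the truncation. -/
abbrev TruncIndex (L : ℕ) : Type := ↥(Finset.Ioc (-(L : ℤ)) (L : ℤ))

/-- The truncated Sambe space `ℂ^[L] ⊗ E`, i.e. the Hilbert sum of copies of `E` indexed by
`[L]`. -/
abbrev TruncSambe (E : Type*) (L : ℕ) : Type _ := PiLp 2 (fun _ : TruncIndex L => E)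

/-- The truncated Floquet Hamiltonian
`∑_{l, l+m ∈ [L]} |l+m⟩⟨l| ⊗ Hₘ - ∑_{l ∈ [L]} l ω |l⟩⟨l| ⊗ 1`. -/
def truncFloquetHamiltonian (T : ℝ) (Hm : ℤ → E →L[ℂ] E) (L : ℕ) :
    TruncSambe E L →ₗ[ℂ] TruncSambe E L where
  toFun Ψ := WithLp.toLp 2 fun l : TruncIndex L =>
    (∑ l' : TruncIndex L, Hm ((l : ℤ) - (l' : ℤ)) (Ψ l')) -
      ((((l : ℤ) : ℝ) * freq T : ℝ) : ℂ) • Ψ l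
  map_add' Ψ Ψ' := by
    ext l
    simp [Finset.sum_add_distrib]
    abel
  map_smul' c Ψ := by
    ext l
    simp [Finset.smul_sum, smul_sub, smul_smul, mul_comm]

end

end Floquet

end

noncomputable section

namespace Floquet

/-! ### Decay of weakly coupled sequences -/

/-! In Fourier space a Floquet eigenstate satisfies `∑ₘ Hₘ φ^{l-m} = (ε + lω) φ^l`. Taking norms, `x
l = ‖φ^l‖` obeys a scalar inequality (`IsWeaklyCoupled`): the growing factor `|l| - κ` times `x l`
is at most `β = α/ω` times a convolution with `e^{-4s|m|}`, where `s = 1/(4ζ)`. For `A(t) = ∑ e^{2t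
g(l)} x(l)²` with a bounded 1-Lipschitz weight `g ≤ |l|`, moving the weight through the convolution
and applying Young's inequality gives `A' ≤ 2(κ + β coth s) A`. Grönwall on `[0, s]` yields
`IsWeaklyCoupled.le_exp`, hence (i).

Each half of (ii) turns an approximate eigenvector of a normal operator into a nearby exact
eigenvalue (`exists_hasEigenvalue_near`). From quasienergy to eigenvalue, the operator is the
symmetric `H_F^L` and the vector is the eigenstate cut off to `[L]`; its residual comes only from
the discarded tail.

Conversely, an eigenvector of `H_F^L`, extended by zero, satisfies the same scalar inequality and so
decays too. Its trigonometric polynomial solves the Schrödinger equation up to a uniformly small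
residual, so over one period the unitary propagator nearly multiplies it by `e^{-iε'T}`
(`norm_propagator_sub_le`). A nearby eigenvalue of this monodromy operator is `e^{-iεT}` for a
quasienergy `ε`, and comparing chord with arc gives the distance modulo `ω` (`abs_modOne_le`). -/

theorem coth_eq_add_inv_one_sub_exp {s : ℝ} (hs : 0 < s) :
    coth s = (1 - Real.exp (-(2 * s)))⁻¹ + Real.exp (-(2 * s)) * (1 - Real.exp (-(2 * s)))⁻¹ := by
  unfold coth
  rw [Real.cosh_eq, Real.sinh_eq]
  have e1 : Real.exp (-(2 * s)) = Real.exp (-s) / Real.exp s := by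
    rw [← Real.exp_sub]; congr 1; ring
  have hpos : 0 < Real.exp s := Real.exp_pos s
  have hlt : Real.exp (-s) < Real.exp s := Real.exp_lt_exp.2 (by linarith)
  rw [e1]
  have h2 : Real.exp s - Real.exp (-s) ≠ 0 := by linarith
  have h3 : 1 - Real.exp (-s) / Real.exp s = (Real.exp s - Real.exp (-s)) / Real.exp s := by
    field_simp
  rw [h3]
  generalize Real.exp (-s) = b at *
  generalize Real.exp s = a at *
  field_simp

theorem hasSum_exp_neg_abs {s : ℝ} (hs : 0 < s) :
    HasSum (fun m : ℤ => Real.exp (-(2 * s * |(m : ℝ)|))) (coth s) := by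
  have hr0 : 0 ≤ Real.exp (-(2 * s)) := (Real.exp_pos _).le
  have hr1 : Real.exp (-(2 * s)) < 1 := by
    rw [Real.exp_lt_one_iff]; linarith
  have hgeo := hasSum_geometric_of_lt_one hr0 hr1
  have hpow : ∀ n : ℕ, Real.exp (-(2 * s)) ^ n = Real.exp (-(2 * s * n)) := by
    intro n
    rw [← Real.exp_nat_mul]; congr 1; ring
  rw [coth_eq_add_inv_one_sub_exp hs]
  refine HasSum.of_nat_of_neg_add_one ?_ ?_
  · convert! hgeo using 2 with n
    rw [hpow, Int.cast_natCast, abs_of_nonneg (Nat.cast_nonneg n)]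
  · convert! hgeo.mul_left (Real.exp (-(2 * s))) using 2 with n
    rw [← pow_succ', hpow]
    have : |((-(n + 1 : ℤ) : ℤ) : ℝ)| = ((n + 1 : ℕ) : ℝ) := by
      push_cast
      rw [abs_neg, abs_of_nonneg (by positivity)]
    rw [this]

theorem summable_exp_neg_abs {s : ℝ} (hs : 0 < s) :
    Summable (fun m : ℤ => Real.exp (-(s * |(m : ℝ)|))) := by
  have h := (hasSum_exp_neg_abs (half_pos hs)).summable
  simpa [mul_div_cancel₀] using h

theorem one_le_coth {s : ℝ} (hs : 0 < s) : 1 ≤ coth s := by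
  have h := (hasSum_exp_neg_abs hs).summable.le_tsum 0 (fun j _ => (Real.exp_pos _).le)
  rw [(hasSum_exp_neg_abs hs).tsum_eq] at h
  simpa using h

theorem coth_le_coth {s t : ℝ} (hs : 0 < s) (hst : s ≤ t) : coth t ≤ coth s := by
  refine hasSum_le (fun m => ?_) (hasSum_exp_neg_abs (hs.trans_le hst)) (hasSum_exp_neg_abs hs)
  gcongr

/-- The shear `(l, m) ↦ (l - m, m)` is a bijection of `ℤ × ℤ`, so translating `y` by `m` changes
neither summability nor the sum. -/
theorem summable_convolution_aux {w y : ℤ → ℝ} (hw : Summable w) (hy : Summable fun l => y l ^ 2) :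
    Summable (fun p : ℤ × ℤ => w p.2 * y p.1 ^ 2) ∧
      Summable (fun p : ℤ × ℤ => w p.2 * y (p.1 - p.2) ^ 2) ∧
      ∑' p : ℤ × ℤ, w p.2 * y (p.1 - p.2) ^ 2 = ∑' p : ℤ × ℤ, w p.2 * y p.1 ^ 2 := by
  have h1 : Summable (fun p : ℤ × ℤ => w p.2 * y p.1 ^ 2) := by
    have := summable_mul_of_summable_norm hy.norm hw.norm
    refine this.congr ?_
    intro p; ring
  let e : ℤ × ℤ ≃ ℤ × ℤ :=
    { toFun := fun p => (p.1 - p.2, p.2)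
      invFun := fun p => (p.1 + p.2, p.2)
      left_inv := fun p => by simp
      right_inv := fun p => by simp }
  exact ⟨h1, (e.summable_iff (f := fun p : ℤ × ℤ => w p.2 * y p.1 ^ 2)).2 h1,
    e.tsum_eq (fun p : ℤ × ℤ => w p.2 * y p.1 ^ 2)⟩

/-- Young's inequality for the quadratic form of a convolution operator on `ℓ²(ℤ)`. -/
theorem convolution_quadratic_form_le {w y : ℤ → ℝ} (hw0 : ∀ m, 0 ≤ w m) (hy0 : ∀ l, 0 ≤ y l)
    (hw : Summable w) (hy : Summable fun l => y l ^ 2) :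
    (∀ l, Summable fun m => w m * y (l - m)) ∧
      Summable (fun l => y l * ∑' m, w m * y (l - m)) ∧
      ∑' l, y l * ∑' m, w m * y (l - m) ≤ (∑' m, w m) * ∑' l, y l ^ 2 := by
  obtain ⟨h1, h2, h3⟩ := summable_convolution_aux hw hy
  -- AM–GM on each pair of indices; by the shear both squares then contribute equally.
  have hle : ∀ p : ℤ × ℤ, w p.2 * (y p.1 * y (p.1 - p.2)) ≤
      (w p.2 * y p.1 ^ 2 + w p.2 * y (p.1 - p.2) ^ 2) / 2 := by
    intro p
    nlinarith [mul_nonneg (hw0 p.2) (sq_nonneg (y p.1 - y (p.1 - p.2)))]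
  have h4 : Summable (fun p : ℤ × ℤ => w p.2 * (y p.1 * y (p.1 - p.2))) :=
    Summable.of_nonneg_of_le
      (fun p => mul_nonneg (hw0 _) (mul_nonneg (hy0 _) (hy0 _))) hle ((h1.add h2).div_const 2)
  have heq : ∀ l, ∑' m, w m * (y l * y (l - m)) = y l * ∑' m, w m * y (l - m) := by
    intro l
    rw [← tsum_mul_left]
    exact tsum_congr fun m => by ring
  have hbd : ∀ l, y l ≤ 1 + ∑' l, y l ^ 2 := by
    intro l
    have := hy.le_tsum l (fun j _ => sq_nonneg _)
    nlinarith [sq_nonneg (y l - 1)]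
  refine ⟨fun l => ?_, ?_, ?_⟩
  · exact Summable.of_nonneg_of_le (fun m => mul_nonneg (hw0 _) (hy0 _))
      (fun m => mul_le_mul_of_nonneg_left (hbd _) (hw0 m)) (hw.mul_right _)
  · exact h4.prod.congr heq
  · calc ∑' l, y l * ∑' m, w m * y (l - m)
        = ∑' p : ℤ × ℤ, w p.2 * (y p.1 * y (p.1 - p.2)) := by
          rw [h4.tsum_prod]; exact tsum_congr fun l => (heq l).symm
      _ ≤ ∑' p : ℤ × ℤ, (w p.2 * y p.1 ^ 2 + w p.2 * y (p.1 - p.2) ^ 2) / 2 :=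
          h4.tsum_le_tsum hle ((h1.add h2).div_const 2)
      _ = ∑' p : ℤ × ℤ, w p.2 * y p.1 ^ 2 := by
          rw [tsum_div_const, h1.tsum_add h2, h3]; ring
      _ = (∑' m, w m) * ∑' l, y l ^ 2 := by
          rw [h1.tsum_prod, ← tsum_mul_left]
          exact tsum_congr fun l => tsum_mul_right (f := w) (a := y l ^ 2)

/-- A nonnegative square-summable sequence that is dominated, up to the growing factor `|l| - κ`, by
an exponentially decaying convolution. -/
structure IsWeaklyCoupled (s β κ : ℝ) (x : ℤ → ℝ) : Prop where
  nonneg : ∀ l, 0 ≤ x l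
  summable_sq : Summable fun l => x l ^ 2
  tsum_sq_le : ∑' l, x l ^ 2 ≤ 1
  le_convolution : ∀ l : ℤ,
    (|(l : ℝ)| - κ) * x l ≤ β * ∑' m : ℤ, Real.exp (-(4 * s * |(m : ℝ)|)) * x (l - m)

section

variable {s β κ : ℝ} {x : ℤ → ℝ} {g : ℤ → ℝ} {N : ℝ}

/-- Since `g` is 1-Lipschitz, carrying `e^{t g}` from `l` to `l - m` costs at most `e^{t|m|} ≤
e^{s|m|}`. The kernel `e^{-4s|m|}` pays for this and still leaves at most `e^{-2s|m|}`, whose sum is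
`coth s`. -/
theorem IsWeaklyCoupled.weighted_le (hx : IsWeaklyCoupled s β κ x) (hs : 0 < s) (hβ : 0 ≤ β)
    (hgl : ∀ l : ℤ, g l ≤ |(l : ℝ)|) (hg : ∀ l m : ℤ, g l ≤ g (l - m) + |(m : ℝ)|)
    {t : ℝ} (ht0 : 0 ≤ t) (hts : t ≤ s)
    (hy : Summable fun l => (Real.exp (t * g l) * x l) ^ 2) (l : ℤ) :
    g l * (Real.exp (t * g l) * x l) ^ 2 ≤ κ * (Real.exp (t * g l) * x l) ^ 2 +
      β * ((Real.exp (t * g l) * x l) * ∑' m : ℤ, Real.exp (-(2 * s * |(m : ℝ)|)) *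
        (Real.exp (t * g (l - m)) * x (l - m))) := by
  set y : ℤ → ℝ := fun l => Real.exp (t * g l) * x l with hydef
  have hy0 : ∀ l, 0 ≤ y l := fun l => mul_nonneg (Real.exp_pos _).le (hx.nonneg l)
  have hw2 := (summable_exp_neg_abs (s := 2 * s) (by positivity))
  have hw4 := (summable_exp_neg_abs (s := 4 * s) (by positivity))
  have c2 := (convolution_quadratic_form_le (fun m => (Real.exp_pos _).le) hy0 hw2 hy).1 l
  have c4 := (convolution_quadratic_form_le (fun m => (Real.exp_pos _).le) hx.nonneg hw4
    hx.summable_sq).1 l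
  have hconv : Real.exp (t * g l) * ∑' m : ℤ, Real.exp (-(4 * s * |(m : ℝ)|)) * x (l - m) ≤
      ∑' m : ℤ, Real.exp (-(2 * s * |(m : ℝ)|)) * y (l - m) := by
    rw [← tsum_mul_left]
    refine (c4.mul_left _).tsum_le_tsum (fun m => ?_) c2
    simp only [hydef]
    rw [← mul_assoc, ← mul_assoc, ← Real.exp_add, ← Real.exp_add]
    refine mul_le_mul_of_nonneg_right (Real.exp_le_exp.2 ?_) (hx.nonneg _)
    have h1 := mul_le_mul_of_nonneg_left (hg l m) ht0
    have h2 := mul_le_mul_of_nonneg_right hts (abs_nonneg (m : ℝ))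
    nlinarith [mul_nonneg hs.le (abs_nonneg (m : ℝ))]
  have h1 : g l * y l ^ 2 ≤ |(l : ℝ)| * y l ^ 2 :=
    mul_le_mul_of_nonneg_right (hgl l) (sq_nonneg _)
  have h2 := mul_le_mul_of_nonneg_left (hx.le_convolution l)
    (mul_nonneg (hy0 l) (Real.exp_pos (t * g l)).le)
  have h3 := mul_le_mul_of_nonneg_left hconv (mul_nonneg hβ (hy0 l))
  have e : y l = Real.exp (t * g l) * x l := rfl
  have h4 : (y l * Real.exp (t * g l)) * ((|(l : ℝ)| - κ) * x l) = (|(l : ℝ)| - κ) * y l ^ 2 := by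
    rw [e]; ring
  rw [h4] at h2
  change g l * y l ^ 2 ≤ κ * y l ^ 2 + β * (y l * _)
  nlinarith

/-- Grönwall's argument in the weight parameter. Boundedness of `g` serves only to make the series
converge and be differentiable term by term; the final bound does not involve `N`. -/
theorem IsWeaklyCoupled.tsum_weighted_le (hx : IsWeaklyCoupled s β κ x) (hs : 0 < s) (hβ : 0 ≤ β)
    (hg0 : ∀ l, 0 ≤ g l) (hgN : ∀ l, g l ≤ N)
    (hgl : ∀ l : ℤ, g l ≤ |(l : ℝ)|) (hg : ∀ l m : ℤ, g l ≤ g (l - m) + |(m : ℝ)|) :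
    (Summable fun l => (Real.exp (s * g l) * x l) ^ 2) ∧
    ∑' l, (Real.exp (s * g l) * x l) ^ 2 ≤ Real.exp (2 * (κ + β * coth s) * s) := by
  have hN : 0 ≤ N := (hg0 0).trans (hgN 0)
  have hsq : ∀ t l, (Real.exp (t * g l) * x l) ^ 2 = Real.exp (2 * g l * t) * x l ^ 2 := by
    intro t l
    rw [mul_pow, ← Real.exp_nat_mul]; congr 2; push_cast; ring
  have hbd : ∀ t < s + 1, ∀ l, Real.exp (2 * g l * t) ≤ Real.exp (2 * N * (s + 1)) := by
    intro t ht l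
    apply Real.exp_le_exp.2
    have := mul_le_mul_of_nonneg_left ht.le (hg0 l)
    have := mul_le_mul_of_nonneg_right (hgN l) (by positivity : 0 ≤ s + 1)
    nlinarith
  have hsum : ∀ t < s + 1, Summable fun l => Real.exp (2 * g l * t) * x l ^ 2 := by
    intro t ht
    exact Summable.of_nonneg_of_le (fun l => by positivity)
      (fun l => mul_le_mul_of_nonneg_right (hbd t ht l) (sq_nonneg _))
      (hx.summable_sq.mul_left _)
  have hbd' : ∀ l, ∀ t ∈ Set.Iio (s + 1), ‖2 * g l * Real.exp (2 * g l * t) * x l ^ 2‖ ≤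
      2 * N * Real.exp (2 * N * (s + 1)) * x l ^ 2 := by
    intro l t ht
    rw [Real.norm_of_nonneg (by have := hg0 l; positivity)]
    exact mul_le_mul_of_nonneg_right (mul_le_mul (by linarith [hgN l]) (hbd t ht l)
      (Real.exp_pos _).le (by positivity)) (sq_nonneg _)
  have hder : ∀ t < s + 1, HasDerivAt (fun t => ∑' l, Real.exp (2 * g l * t) * x l ^ 2)
      (∑' l, 2 * g l * Real.exp (2 * g l * t) * x l ^ 2) t := by
    intro t ht
    refine hasDerivAt_tsum_of_isPreconnected (u := fun l => 2 * N * Real.exp (2 * N * (s + 1)) *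
      x l ^ 2) (t := Set.Iio (s + 1)) (y₀ := 0)
      (hx.summable_sq.mul_left _) isOpen_Iio isPreconnected_Iio ?_ hbd'
      (by simp only [Set.mem_Iio]; linarith) (hsum 0 (by linarith)) ht
    intro l t _
    have h := ((hasDerivAt_id t).const_mul (2 * g l)).exp.mul_const (x l ^ 2)
    convert! h using 1
    simp only [id]; ring
  set K : ℝ := 2 * (κ + β * coth s) with hK
  set A : ℝ → ℝ := fun t => ∑' l, Real.exp (2 * g l * t) * x l ^ 2 with hA
  have hle : ∀ t, 0 ≤ t → t ≤ s → ∑' l, 2 * g l * Real.exp (2 * g l * t) * x l ^ 2 ≤ K * A t := by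
    intro t ht0 hts
    have hts' : t < s + 1 := by linarith
    have hy : Summable fun l => (Real.exp (t * g l) * x l) ^ 2 :=
      (hsum t hts').congr fun l => (hsq t l).symm
    obtain ⟨-, q1, q2⟩ := convolution_quadratic_form_le (w := fun m : ℤ =>
      Real.exp (-(2 * s * |(m : ℝ)|))) (y := fun l => Real.exp (t * g l) * x l)
      (fun m => (Real.exp_pos _).le) (fun l => mul_nonneg (Real.exp_pos _).le (hx.nonneg l))
      (summable_exp_neg_abs (by positivity)) hy
    rw [(hasSum_exp_neg_abs hs).tsum_eq] at q2
    have hpt := hx.weighted_le hs hβ hgl hg ht0 hts hy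
    have hl : Summable fun l => g l * (Real.exp (t * g l) * x l) ^ 2 := by
      refine Summable.of_nonneg_of_le (fun l => mul_nonneg (hg0 l) (sq_nonneg _))
        (fun l => mul_le_mul_of_nonneg_right (hgN l) (sq_nonneg _)) (hy.mul_left N)
    have := hl.tsum_le_tsum hpt ((hy.mul_left κ).add (q1.mul_left β))
    rw [(hy.mul_left κ).tsum_add (q1.mul_left β), tsum_mul_left, tsum_mul_left] at this
    have e1 : ∑' l, 2 * g l * Real.exp (2 * g l * t) * x l ^ 2 =
        2 * ∑' l, g l * (Real.exp (t * g l) * x l) ^ 2 := by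
      rw [← tsum_mul_left]
      exact tsum_congr fun l => by rw [hsq]; ring
    have e2 : A t = ∑' l, (Real.exp (t * g l) * x l) ^ 2 := tsum_congr fun l => (hsq t l).symm
    rw [e1, e2, hK]
    have := mul_le_mul_of_nonneg_left q2 hβ
    nlinarith
  have hBder : ∀ t < s + 1, HasDerivAt (fun t => A t * Real.exp (-(K * t)))
      ((∑' l, 2 * g l * Real.exp (2 * g l * t) * x l ^ 2 - K * A t) * Real.exp (-(K * t))) t := by
    intro t ht
    have h := (hder t ht).mul ((hasDerivAt_id t).const_mul K).neg.exp
    convert! h using 1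
    simp [id]; ring
  have hanti : AntitoneOn (fun t => A t * Real.exp (-(K * t))) (Set.Icc 0 s) := by
    refine antitoneOn_of_deriv_nonpos (convex_Icc 0 s) ?_ ?_ ?_
    · intro t ht
      exact (hBder t (by linarith [ht.2])).continuousAt.continuousWithinAt
    · intro t ht
      rw [interior_Icc] at ht
      exact (hBder t (by linarith [ht.2])).differentiableAt.differentiableWithinAt
    · intro t ht
      rw [interior_Icc] at ht
      rw [(hBder t (by linarith [ht.2])).deriv]
      exact mul_nonpos_of_nonpos_of_nonneg (by linarith [hle t ht.1.le ht.2.le])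
        (Real.exp_pos _).le
  have hfin := hanti (Set.left_mem_Icc.2 hs.le) (Set.right_mem_Icc.2 hs.le) hs.le
  have hA0 : A 0 ≤ 1 := by simpa [hA] using hx.tsum_sq_le
  simp only [mul_zero, neg_zero, Real.exp_zero, mul_one] at hfin
  refine ⟨(hsum s (by linarith)).congr fun l => (hsq s l).symm, ?_⟩
  have e2 : A s = ∑' l, (Real.exp (s * g l) * x l) ^ 2 := tsum_congr fun l => (hsq s l).symm
  rw [← e2]
  calc A s = (A s * Real.exp (-(K * s))) * Real.exp (K * s) := by
        rw [mul_assoc, ← Real.exp_add]; simp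
    _ ≤ 1 * Real.exp (K * s) := by gcongr; linarith
    _ = _ := one_mul _

/-- Exponential decay of weakly coupled sequences. -/
theorem IsWeaklyCoupled.le_exp (hx : IsWeaklyCoupled s β κ x) (hs : 0 < s) (hβ : 0 ≤ β) (l : ℤ) :
    x l ≤ Real.exp (-(s * (|(l : ℝ)| - κ)) + s * (β * coth s)) := by
  -- Capping `|k|` at `|l|` keeps the weight bounded and 1-Lipschitz while retaining its full value
  -- at `l`; one term of the weighted sum then suffices.
  obtain ⟨h1, h2⟩ := hx.tsum_weighted_le (g := fun k : ℤ => min |(k : ℝ)| |(l : ℝ)|)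
    (N := |(l : ℝ)|) hs hβ (fun k => by positivity) (fun k => min_le_right _ _)
    (fun k => min_le_left _ _) (fun k m => by
      have h : |(k : ℝ)| ≤ |((k - m : ℤ) : ℝ)| + |(m : ℝ)| := by
        have := abs_add_le ((k - m : ℤ) : ℝ) (m : ℝ)
        simpa using this
      rw [← min_add_add_right]
      exact min_le_min h (by have := abs_nonneg (m : ℝ); linarith))
  have h3 := (h1.le_tsum l (fun j _ => sq_nonneg _)).trans h2
  simp only [min_self] at h3
  have h4 : Real.exp (2 * (κ + β * coth s) * s) = Real.exp ((κ + β * coth s) * s) ^ 2 := by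
    rw [← Real.exp_nat_mul]; congr 1; push_cast; ring
  rw [h4] at h3
  have h5 := abs_le_of_sq_le_sq' h3 (Real.exp_pos _).le
  calc x l = Real.exp (-(s * |(l : ℝ)|)) * (Real.exp (s * |(l : ℝ)|) * x l) := by
        rw [← mul_assoc, ← Real.exp_add]; simp
    _ ≤ Real.exp (-(s * |(l : ℝ)|)) * Real.exp ((κ + β * coth s) * s) := by gcongr; exact h5.2
    _ = _ := by rw [← Real.exp_add]; congr 1; ring

theorem IsWeaklyCoupled.summable_convolution (hx : IsWeaklyCoupled s β κ x) (hs : 0 < s) (l : ℤ) :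
    Summable fun m : ℤ => Real.exp (-(4 * s * |(m : ℝ)|)) * x (l - m) :=
  (convolution_quadratic_form_le (fun m => (Real.exp_pos _).le) hx.nonneg
    (summable_exp_neg_abs (s := 4 * s) (by positivity)) hx.summable_sq).1 l

/-- Exponential decay of the convolution. -/
theorem IsWeaklyCoupled.convolution_le (hx : IsWeaklyCoupled s β κ x) (hs : 0 < s) (hβ : 0 ≤ β)
    (l : ℤ) : ∑' m : ℤ, Real.exp (-(4 * s * |(m : ℝ)|)) * x (l - m) ≤
      coth s * Real.exp (s * (κ + β * coth s)) * Real.exp (-(s * |(l : ℝ)|)) := by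
  have hc := hasSum_exp_neg_abs hs
  rw [← hc.tsum_eq, mul_assoc, ← tsum_mul_right]
  refine (hx.summable_convolution hs l).tsum_le_tsum (fun m => ?_) (hc.summable.mul_right _)
  calc Real.exp (-(4 * s * |(m : ℝ)|)) * x (l - m)
      ≤ Real.exp (-(4 * s * |(m : ℝ)|)) *
          Real.exp (-(s * (|((l - m : ℤ) : ℝ)| - κ)) + s * (β * coth s)) := by
        gcongr; exact hx.le_exp hs hβ _
    _ ≤ _ := by
        rw [hc.tsum_eq, ← Real.exp_add, ← Real.exp_add, ← Real.exp_add]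
        apply Real.exp_le_exp.2
        have h : |(l : ℝ)| ≤ |((l - m : ℤ) : ℝ)| + |(m : ℝ)| := by
          have := abs_add_le ((l - m : ℤ) : ℝ) (m : ℝ)
          simpa using this
        have := mul_le_mul_of_nonneg_left h hs.le
        nlinarith [mul_nonneg hs.le (abs_nonneg (m : ℝ))]

end

/-! ### Approximate eigenvectors of normal operators -/

section

variable {V : Type*} [NormedAddCommGroup V] [InnerProductSpace ℂ V] [FiniteDimensional ℂ V]

/-- A normal operator with an approximate eigenvector has an eigenvalue nearby. -/
theorem exists_hasEigenvalue_near {N N' : V →ₗ[ℂ] V}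
    (hadj : ∀ u v, inner ℂ (N u) v = inner ℂ u (N' v)) (hcomm : ∀ v, N (N' v) = N' (N v))
    {μ : ℂ} {η : ℝ} {v : V} (hv : v ≠ 0) (h : ‖N v - μ • v‖ ≤ η * ‖v‖) :
    ∃ z : ℂ, Module.End.HasEigenvalue N z ∧ ‖z - μ‖ ≤ η := by
  have : Nontrivial V := ⟨⟨v, 0, hv⟩⟩
  -- `A = (N - μ)*(N - μ)`; its smallest eigenvalue is a Rayleigh minimum, so testing on `v` bounds
  -- it by `η²`.
  set A : V →ₗ[ℂ] V := (N' - (starRingEnd ℂ μ) • LinearMap.id) ∘ₗ (N - μ • LinearMap.id) with hA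
  have hadj' : ∀ u v, inner ℂ (N' u) v = inner ℂ u (N v) := by
    intro u v
    rw [← inner_conj_symm, ← hadj, inner_conj_symm]
  have hAinner : ∀ u w, inner ℂ (A u) w = inner ℂ (N u - μ • u) (N w - μ • w) := by
    intro u w
    simp only [hA, LinearMap.comp_apply, LinearMap.sub_apply, LinearMap.smul_apply,
      LinearMap.id_apply, inner_sub_left, inner_sub_right, inner_smul_left, inner_smul_right, hadj',
      RingHomCompTriple.comp_apply, RingHom.id_apply]
  have hsymm : A.IsSymmetric := by
    intro u w
    rw [hAinner, ← inner_conj_symm u, hAinner, inner_conj_symm]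
  have hAnorm : ∀ u, RCLike.re (inner ℂ (A u) u) = ‖N u - μ • u‖ ^ 2 := by
    intro u
    rw [hAinner, inner_self_eq_norm_sq]
  have hη : 0 ≤ η := by
    have h1 := (norm_nonneg _).trans h
    exact nonneg_of_mul_nonneg_left h1 (norm_pos_iff.2 hv)
  have hev := hsymm.hasEigenvalue_iInf_of_finiteDimensional
  set a : ℝ := ⨅ x : { x : V // x ≠ 0 }, RCLike.re (inner ℂ (A x) (x : V)) / ‖(x : V)‖ ^ 2 with ha
  have hale : a ≤ η ^ 2 := by
    have hb : BddBelow (Set.range fun x : { x : V // x ≠ 0 } =>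
        RCLike.re (inner ℂ (A x) (x : V)) / ‖(x : V)‖ ^ 2) := by
      refine ⟨0, ?_⟩
      rintro _ ⟨x, rfl⟩
      simp only [hAnorm]
      positivity
    refine (ciInf_le hb ⟨v, hv⟩).trans ?_
    simp only [hAnorm]
    rw [div_le_iff₀ (by have := norm_pos_iff.2 hv; positivity), ← mul_pow]
    exact pow_le_pow_left₀ (norm_nonneg _) h 2
  set S := Module.End.eigenspace A (a : ℂ) with hS
  -- Normality makes `N` commute with `A`, so `N` has an eigenvector inside this eigenspace, and
  -- there `‖z - μ‖² = a`.
  have hSinv : ∀ u ∈ S, N u ∈ S := by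
    intro u hu
    rw [hS, Module.End.mem_eigenspace_iff] at hu ⊢
    rw [← map_smul, ← hu]
    simp [hA, hcomm]
  have : Nontrivial S := Submodule.nontrivial_iff_ne_bot.2 hev
  obtain ⟨z, hz⟩ := Module.End.exists_eigenvalue (N.restrict hSinv)
  obtain ⟨w, hw⟩ := hz.exists_hasEigenvector
  have hw1 : N (w : V) = z • (w : V) := by
    have := congrArg Subtype.val hw.apply_eq_smul
    simpa using this
  have hw0 : (w : V) ≠ 0 := fun h0 => hw.2 (Subtype.ext h0)
  refine ⟨z, Module.End.hasEigenvalue_of_hasEigenvector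
    ⟨Module.End.mem_eigenspace_iff.2 hw1, hw0⟩, ?_⟩
  have h1 := hAnorm w
  rw [Module.End.mem_eigenspace_iff.1 w.2, hw1, ← sub_smul, norm_smul, mul_pow,
    inner_smul_left, inner_self_eq_norm_sq_to_K] at h1
  have h2 : a * ‖(w : V)‖ ^ 2 = ‖z - μ‖ ^ 2 * ‖(w : V)‖ ^ 2 := by
    rw [← h1]
    simp [← Complex.ofReal_pow]
  have h3 := mul_right_cancel₀ (pow_ne_zero 2 (norm_ne_zero_iff.2 hw0)) h2
  exact abs_le_of_sq_le_sq (by rw [← h3]; exact hale) hη |> (le_abs_self _).trans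

end

/-! ### Global solutions of linear differential equations -/

section

variable {𝔸 : Type*} [NormedRing 𝔸] [NormedAlgebra ℝ 𝔸]

/-- The terms of the Dyson series of the equation `U' = B U`. -/
def dysonTerm (B : ℝ → 𝔸) (t₀ : ℝ) : ℕ → ℝ → 𝔸
  | 0 => fun _ => 1
  | n + 1 => fun t => ∫ τ in t₀..t, B τ * dysonTerm B t₀ n τ

variable {B : ℝ → 𝔸} (t₀ : ℝ)

theorem continuous_dysonTerm [CompleteSpace 𝔸] (hB : Continuous B) (n : ℕ) :
    Continuous (dysonTerm B t₀ n) := by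
  induction n with
  | zero => exact continuous_const
  | succ n ih =>
    exact intervalIntegral.continuous_primitive
      (fun a b => (hB.mul ih).intervalIntegrable a b) t₀

theorem hasDerivAt_dysonTerm_succ [CompleteSpace 𝔸] (hB : Continuous B) (n : ℕ) (t : ℝ) :
    HasDerivAt (dysonTerm B t₀ (n + 1)) (B t * dysonTerm B t₀ n t) t :=
  ((hB.mul (continuous_dysonTerm t₀ hB n)).integral_hasStrictDerivAt t₀ t).hasDerivAt

theorem norm_dysonTerm_le [CompleteSpace 𝔸] (hB : Continuous B) {K : ℝ} (hK : ∀ t, ‖B t‖ ≤ K)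
    (n : ℕ) (t : ℝ) :
    ‖dysonTerm B t₀ n t‖ ≤ ‖(1 : 𝔸)‖ * ((K * |t - t₀|) ^ n / n.factorial) := by
  have hK0 : 0 ≤ K := (norm_nonneg _).trans (hK 0)
  induction n generalizing t with
  | zero => simp [dysonTerm]
  | succ n ih =>
    calc ‖dysonTerm B t₀ (n + 1) t‖
        ≤ ∫ τ in Set.uIoc t₀ t, ‖B τ * dysonTerm B t₀ n τ‖ :=
          intervalIntegral.norm_integral_le_integral_norm_uIoc
      _ ≤ ∫ τ in Set.uIoc t₀ t, (K * (‖(1 : 𝔸)‖ * (K ^ n / n.factorial))) * |τ - t₀| ^ n := by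
          refine MeasureTheory.integral_mono ?_ ?_ ?_
          · exact ((hB.mul (continuous_dysonTerm t₀ hB n)).norm.intervalIntegrable t₀ t).def'
          · exact ((Continuous.intervalIntegrable (by fun_prop) t₀ t).def')
          · intro τ
            refine (norm_mul_le _ _).trans ((mul_le_mul (hK τ) (ih τ) (norm_nonneg _) hK0).trans ?_)
            rw [mul_pow]
            apply le_of_eq
            ring
      _ = _ := by
          rw [MeasureTheory.integral_const_mul, integral_pow_abs_sub_uIoc, Nat.factorial_succ,
            mul_pow]
          push_cast
          field_simp
          ring

/-- A linear differential equation with bounded continuous coefficient has a global solution. -/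
theorem exists_propagator [CompleteSpace 𝔸] (hB : Continuous B) {K : ℝ} (hK : ∀ t, ‖B t‖ ≤ K) :
    ∃ U : ℝ → 𝔸, U t₀ = 1 ∧ ∀ t, HasDerivAt U (B t * U t) t := by
  have hK0 : 0 ≤ K := (norm_nonneg _).trans (hK 0)
  have hsum : ∀ t, Summable fun n => dysonTerm B t₀ n t := fun t =>
    Summable.of_norm_bounded ((Real.summable_pow_div_factorial (K * |t - t₀|)).mul_left _)
      (fun n => norm_dysonTerm_le t₀ hB hK n t)
  refine ⟨fun t => ∑' n, dysonTerm B t₀ n t, ?_, fun t => ?_⟩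
  · beta_reduce
    rw [tsum_eq_single 0]
    · rfl
    · intro n hn
      obtain ⟨k, rfl⟩ := Nat.exists_eq_succ_of_ne_zero hn
      simp [dysonTerm]
  -- Termwise differentiation needs a summable bound only locally; this ball contains both `t₀` and
  -- `t`.
  · set R : ℝ := |t - t₀| + 1 with hR
    have hR0 : 0 < R := by positivity
    have hu : Summable fun n : ℕ => K * (‖(1 : 𝔸)‖ * ((K * R) ^ n / n.factorial)) :=
      ((Real.summable_pow_div_factorial (K * R)).mul_left _).mul_left K
    have h0 : Summable fun n => dysonTerm B t₀ (n + 1) t₀ :=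
      (summable_nat_add_iff (f := fun n => dysonTerm B t₀ n t₀) 1).2 (hsum t₀)
    have hd : HasDerivAt (fun t => ∑' n, dysonTerm B t₀ (n + 1) t)
        (∑' n, B t * dysonTerm B t₀ n t) t := by
      refine hasDerivAt_tsum_of_isPreconnected
        (g := fun n t => dysonTerm B t₀ (n + 1) t) (g' := fun n t => B t * dysonTerm B t₀ n t)
        (t := Metric.ball t₀ R) (y₀ := t₀) hu Metric.isOpen_ball
        (convex_ball _ _).isPreconnected
        (fun n y _ => hasDerivAt_dysonTerm_succ t₀ hB n y) ?_ (Metric.mem_ball_self hR0)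
        h0 ?_
      · intro n y hy
        have hy' : |y - t₀| ≤ R := by
          rw [Metric.mem_ball, Real.dist_eq] at hy; exact hy.le
        refine (norm_mul_le _ _).trans (mul_le_mul (hK y) ?_ (norm_nonneg _) hK0)
        refine (norm_dysonTerm_le t₀ hB hK n y).trans ?_
        gcongr
      · rw [Metric.mem_ball, Real.dist_eq]; linarith
    have h2 : (fun t => ∑' n, dysonTerm B t₀ n t) =
        fun t => 1 + ∑' n, dysonTerm B t₀ (n + 1) t := by
      funext t
      rw [(hsum t).tsum_eq_zero_add]
      rfl
    rw [h2]
    have h3 := hd.const_add 1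
    rw [(hsum t).tsum_mul_left, (hsum t).tsum_eq_zero_add] at h3
    exact h3

end

/-! ### Fourier components -/

/-- The phase factor `e^{ilωt}`. -/
def phase (T : ℝ) (l : ℤ) (t : ℝ) : ℂ := Complex.exp (Complex.I * (l * freq T * t : ℝ))

section phase

variable (T : ℝ)

theorem phase_neg (l : ℤ) (t : ℝ) :
    phase T (-l) t = Complex.exp (-(Complex.I * (l * freq T * t : ℝ))) := by
  unfold phase; congr 1; push_cast; ring

theorem phase_zero (t : ℝ) : phase T 0 t = 1 := by simp [phase]

theorem phase_add (l m : ℤ) (t : ℝ) : phase T (l + m) t = phase T l t * phase T m t := by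
  unfold phase; rw [← Complex.exp_add]; congr 1; push_cast; ring

theorem norm_phase (l : ℤ) (t : ℝ) : ‖phase T l t‖ = 1 := by
  unfold phase; rw [mul_comm]; exact Complex.norm_exp_ofReal_mul_I _

theorem conj_phase (l : ℤ) (t : ℝ) : (starRingEnd ℂ) (phase T l t) = phase T (-l) t := by
  unfold phase
  rw [← Complex.exp_conj, map_mul, Complex.conj_I, Complex.conj_ofReal]
  congr 1; push_cast; ring

theorem hasDerivAt_phase (l : ℤ) (t : ℝ) :
    HasDerivAt (phase T l) (Complex.I * (l * freq T : ℝ) * phase T l t) t := by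
  have h := (((hasDerivAt_id t).const_mul (l * freq T)).ofReal_comp.const_mul Complex.I).cexp
  refine h.congr_deriv ?_
  simp [phase]; ring

@[fun_prop]
theorem continuous_phase (l : ℤ) : Continuous (phase T l) := by
  unfold phase; fun_prop

variable {T}

theorem freq_mul_period (hT : T ≠ 0) : freq T * T = 2 * Real.pi := by
  unfold freq; field_simp

theorem freq_pos (hT : 0 < T) : 0 < freq T := by unfold freq; positivity

theorem phase_add_period (hT : T ≠ 0) (l : ℤ) (t : ℝ) : phase T l (t + T) = phase T l t := by
  unfold phase
  have h : ((l * freq T * (t + T) : ℝ) : ℂ) =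
      ((l * freq T * t : ℝ) : ℂ) + l * (2 * Real.pi) := by
    rw [mul_add, mul_assoc _ (freq T) T, freq_mul_period hT]; push_cast; ring
  rw [h, mul_add, Complex.exp_add]
  have h2 : Complex.I * ((l : ℂ) * (2 * Real.pi)) = l * (2 * Real.pi * Complex.I) := by ring
  rw [h2, Complex.exp_int_mul_two_pi_mul_I, mul_one]

theorem integral_phase (hT : 0 < T) (l : ℤ) :
    ∫ t in (0 : ℝ)..T, phase T l t = if l = 0 then (T : ℂ) else 0 := by
  split_ifs with h
  · subst h; simp [phase_zero]
  · have hc : Complex.I * (l * freq T : ℝ) ≠ 0 := by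
      refine mul_ne_zero Complex.I_ne_zero (Complex.ofReal_ne_zero.2 ?_)
      exact mul_ne_zero (Int.cast_ne_zero.2 h) (freq_pos hT).ne'
    have h1 := intervalIntegral.integral_eq_sub_of_hasDerivAt (a := 0) (b := T)
      (fun t _ => hasDerivAt_phase T l t) (Continuous.intervalIntegrable (by fun_prop) _ _)
    rw [intervalIntegral.integral_const_mul] at h1
    have h2 := phase_add_period hT.ne' l 0
    rw [zero_add] at h2
    rw [h2, sub_self] at h1
    exact (mul_eq_zero.1 h1).resolve_left hc

end phase

section

variable {E F : Type*} [NormedAddCommGroup E] [InnerProductSpace ℂ E]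
  [NormedAddCommGroup F] [InnerProductSpace ℂ F]
variable {T : ℝ}

theorem fourierComponent_eq (φ : ℝ → E) (l : ℤ) :
    fourierComponent T φ l = (T⁻¹ : ℝ) • ∫ t in (0 : ℝ)..T, phase T l t • φ t := rfl

theorem fourierComponent_phase_smul (φ : ℝ → E) (l m : ℤ) :
    fourierComponent T (fun t => phase T (-m) t • φ t) l = fourierComponent T φ (l - m) := by
  simp only [fourierComponent_eq, smul_smul, ← phase_add, sub_eq_add_neg]

theorem fourierComponent_const [CompleteSpace E] (hT : 0 < T) (c : E) (l : ℤ) :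
    fourierComponent T (fun _ => c) l = if l = 0 then c else 0 := by
  rw [fourierComponent_eq, intervalIntegral.integral_smul_const, integral_phase hT]
  split_ifs
  · rw [Complex.coe_smul, smul_smul, inv_mul_cancel₀ hT.ne', one_smul]
  · simp

theorem fourierComponent_phase_smul_const [CompleteSpace E] (hT : 0 < T) (c : E) (l m : ℤ) :
    fourierComponent T (fun t => phase T (-m) t • c) l = if l = m then c else 0 := by
  rw [fourierComponent_phase_smul, fourierComponent_const hT]
  simp [sub_eq_zero]

theorem fourierComponent_clm [CompleteSpace E] [CompleteSpace F] (A : E →L[ℂ] F) {φ : ℝ → E}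
    (hφ : Continuous φ) (l : ℤ) :
    fourierComponent T (fun t => A (φ t)) l = A (fourierComponent T φ l) := by
  have h := (A.restrictScalars ℝ).intervalIntegral_comp_comm
    (μ := MeasureTheory.volume) (a := 0) (b := T) (f := fun t => phase T l t • φ t)
    (Continuous.intervalIntegrable (by fun_prop) _ _)
  simp only [ContinuousLinearMap.coe_restrictScalars', map_smul] at h
  rw [fourierComponent_eq, fourierComponent_eq, h]
  exact ((A.restrictScalars ℝ).map_smul _ _).symm

theorem fourierComponent_add {φ ψ : ℝ → E} (hφ : Continuous φ) (hψ : Continuous ψ) (l : ℤ) :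
    fourierComponent T (fun t => φ t + ψ t) l =
      fourierComponent T φ l + fourierComponent T ψ l := by
  simp only [fourierComponent_eq, smul_add]
  rw [intervalIntegral.integral_add (Continuous.intervalIntegrable (by fun_prop) _ _)
    (Continuous.intervalIntegrable (by fun_prop) _ _), smul_add]

theorem fourierComponent_const_smul (c : ℂ) (φ : ℝ → E) (l : ℤ) :
    fourierComponent T (fun t => c • φ t) l = c • fourierComponent T φ l := by
  simp only [fourierComponent_eq]
  simp only [smul_comm _ c]
  rw [intervalIntegral.integral_smul, smul_comm]

theorem hasSum_fourierComponent [CompleteSpace E] {f : ℤ → ℝ → E} {g : ℝ → E} {u : ℤ → ℝ}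
    (hf : ∀ m, Continuous (f m)) (hu : Summable u) (hfu : ∀ m t, ‖f m t‖ ≤ u m)
    (hg : ∀ t, HasSum (fun m => f m t) (g t)) (l : ℤ) :
    HasSum (fun m => fourierComponent T (f m) l) (fourierComponent T g l) := by
  simp only [fourierComponent_eq]
  refine HasSum.const_smul _ ?_
  refine intervalIntegral.hasSum_integral_of_dominated_convergence (fun m _ => u m)
    (fun m => Continuous.aestronglyMeasurable (by have := hf m; fun_prop))
    (fun m => MeasureTheory.ae_of_all _ fun t _ => ?_)
    (MeasureTheory.ae_of_all _ fun t _ => hu) intervalIntegrable_const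
    (MeasureTheory.ae_of_all _ fun t _ => (hg t).const_smul _)
  rw [norm_smul, norm_phase, one_mul]
  exact hfu m t

theorem fourierComponent_sum_phase_smul [CompleteSpace E] (hT : 0 < T) (S : Finset ℤ) (c : ℤ → E)
    (l : ℤ) : fourierComponent T (fun t => ∑ m ∈ S, phase T (-m) t • c m) l =
      if l ∈ S then c l else 0 := by
  have h := hasSum_fourierComponent (T := T) (l := l)
    (f := fun m t => phase T (-m) t • (if m ∈ S then c m else 0))
    (g := fun t => ∑ m ∈ S, phase T (-m) t • c m) (u := fun m => if m ∈ S then ‖c m‖ else 0)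
    (fun m => by fun_prop)
    (summable_of_ne_finset_zero (s := S) fun m hm => if_neg hm)
    (fun m t => by
      rw [norm_smul, norm_phase, one_mul]; split_ifs <;> simp)
    (fun t => by
      have : ∑ m ∈ S, phase T (-m) t • c m =
          ∑ m ∈ S, phase T (-m) t • (if m ∈ S then c m else 0) :=
        Finset.sum_congr rfl fun m hm => by rw [if_pos hm]
      rw [this]
      exact hasSum_sum_of_ne_finset_zero fun m hm => by simp [hm])
  refine h.unique ?_
  simp only [fourierComponent_phase_smul_const hT]
  have h' := hasSum_single (f := fun m => if l = m then if m ∈ S then c m else 0 else 0) l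
    (fun m hm => if_neg (Ne.symm hm))
  rwa [if_pos rfl] at h'

/-- Integration by parts for Fourier components. -/
theorem fourierComponent_deriv [CompleteSpace E] (hT : 0 < T) {φ φ' : ℝ → E}
    (hφ : ∀ t, HasDerivAt φ (φ' t) t) (hφ' : Continuous φ') (hper : ∀ t, φ (t + T) = φ t) (l : ℤ) :
    fourierComponent T φ' l =
      -((Complex.I * (l * freq T : ℝ)) • fourierComponent T φ l) := by
  have hc : Continuous φ := continuous_iff_continuousAt.2 fun t => (hφ t).continuousAt
  have h := intervalIntegral.integral_eq_sub_of_hasDerivAt (a := 0) (b := T)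
    (fun t _ => (hasDerivAt_phase T l t).smul (hφ t))
    (Continuous.intervalIntegrable (by fun_prop) _ _)
  have h2 := phase_add_period hT.ne' l 0
  have h3 := hper 0
  rw [zero_add] at h2 h3
  simp only [Pi.smul_apply', h2, h3, sub_self] at h
  rw [intervalIntegral.integral_add (Continuous.intervalIntegrable (by fun_prop) _ _)
    (Continuous.intervalIntegrable (by fun_prop) _ _)] at h
  simp only [mul_smul (Complex.I * _)] at h
  rw [intervalIntegral.integral_smul] at h
  rw [fourierComponent_eq, fourierComponent_eq, smul_comm _ (T⁻¹ : ℝ), ← smul_neg,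
    eq_neg_of_add_eq_zero_left h]

/-- The sign flips because components here are taken against `e^{+ilωt}`. -/
theorem fourierComponent_eq_fourierCoeffOn (hT : 0 < T) (f : ℝ → ℂ) (l : ℤ) :
    fourierComponent T f l = fourierCoeffOn hT f (-l) := by
  rw [fourierCoeffOn_eq_integral, fourierComponent_eq]
  simp only [sub_zero, one_div, neg_neg]
  congr 1
  refine intervalIntegral.integral_congr fun t _ => ?_
  rw [fourier_coe_apply, phase]
  congr 2
  unfold freq
  push_cast
  ring

/-- Parseval's identity. -/
theorem hasSum_norm_fourierComponent_sq [FiniteDimensional ℂ E] (hT : 0 < T) {φ : ℝ → E}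
    (hφ : Continuous φ) :
    HasSum (fun l => ‖fourierComponent T φ l‖ ^ 2) (T⁻¹ * ∫ t in (0 : ℝ)..T, ‖φ t‖ ^ 2) := by
  have : CompleteSpace E := FiniteDimensional.complete ℂ E
  -- Scalar Parseval is applied to each coordinate and summed.
  set b := stdOrthonormalBasis ℂ E with hb
  have h1 : ∀ i, HasSum (fun l => ‖inner ℂ (b i) (fourierComponent T φ l)‖ ^ 2)
      (T⁻¹ * ∫ t in (0 : ℝ)..T, ‖inner ℂ (b i) (φ t)‖ ^ 2) := by
    intro i
    have hcont : Continuous fun t => inner ℂ (b i) (φ t) := by fun_prop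
    have hL2 : MeasureTheory.MemLp (fun t => inner ℂ (b i) (φ t)) 2
        (MeasureTheory.volume.restrict (Set.Ioc 0 T)) := by
      obtain ⟨K, hK⟩ := (isCompact_Icc (a := (0 : ℝ)) (b := T)).exists_bound_of_continuousOn
        hcont.continuousOn
      refine MeasureTheory.MemLp.of_bound hcont.aestronglyMeasurable K ?_
      exact (MeasureTheory.ae_restrict_iff' measurableSet_Ioc).2
        (MeasureTheory.ae_of_all _ fun t ht => hK t (Set.Ioc_subset_Icc_self ht))
    have h := hasSum_sq_fourierCoeffOn hT hL2
    rw [← (Equiv.neg ℤ).hasSum_iff] at h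
    rw [sub_zero, smul_eq_mul] at h
    refine (congrArg (fun f => HasSum f _) ?_).mp h
    funext l
    simp only [Function.comp_apply, Equiv.neg_apply]
    rw [← fourierComponent_eq_fourierCoeffOn]
    exact congrArg (fun z : ℂ => ‖z‖ ^ 2) (fourierComponent_clm (innerSL ℂ (b i)) hφ l)
  have h2 := hasSum_sum (s := Finset.univ) fun i _ => h1 i
  simp only [OrthonormalBasis.sum_sq_norm_inner_right] at h2
  rw [← Finset.mul_sum, ← intervalIntegral.integral_finsetSum
    (fun i _ => Continuous.intervalIntegrable (by fun_prop) _ _)] at h2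
  simpa only [OrthonormalBasis.sum_sq_norm_inner_right] using h2

end

/-! ### The Hamiltonian and its Floquet eigenstates -/

section

variable {E : Type*} [NormedAddCommGroup E] [InnerProductSpace ℂ E]
  {T α ζ : ℝ} {H : ℝ → E →L[ℂ] E} {Hm : ℤ → E →L[ℂ] E}

namespace IsExpDecayHamiltonian

/-- Rewrites the decay rate `1/ζ` as `4s` with `s = 1/(4ζ)`, the form used by `IsWeaklyCoupled`. -/
theorem norm_le_exp (hH : IsExpDecayHamiltonian T α ζ H Hm) (m : ℤ) :
    ‖Hm m‖ ≤ α * Real.exp (-(4 * (1 / (4 * ζ)) * |(m : ℝ)|)) := by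
  refine (hH.norm_le m).trans_eq ?_
  congr 2
  rw [one_div, mul_inv, ← mul_assoc, mul_inv_cancel₀ (by norm_num : (4 : ℝ) ≠ 0)]
  ring

theorem summable_norm (hH : IsExpDecayHamiltonian T α ζ H Hm) (hζ : 0 < ζ) :
    Summable fun m => ‖Hm m‖ :=
  Summable.of_nonneg_of_le (fun _ => norm_nonneg _) hH.norm_le_exp
    ((summable_exp_neg_abs (s := 4 * (1 / (4 * ζ))) (by positivity)).mul_left α)

theorem hasSum_phase (hH : IsExpDecayHamiltonian T α ζ H Hm) (t : ℝ) :
    HasSum (fun m : ℤ => phase T (-m) t • Hm m) (H t) := by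
  simpa only [phase_neg] using hH.hasSum t

theorem norm_apply_le (hH : IsExpDecayHamiltonian T α ζ H Hm) (hζ : 0 < ζ) (t : ℝ) :
    ‖H t‖ ≤ ∑' m, ‖Hm m‖ := by
  have h : ∀ m, ‖phase T (-m) t • Hm m‖ = ‖Hm m‖ := fun m => by
    rw [norm_smul, norm_phase, one_mul]
  rw [← (hH.hasSum_phase t).tsum_eq]
  refine (norm_tsum_le_tsum_norm ?_).trans_eq (tsum_congr h)
  simpa only [h] using hH.summable_norm hζ

protected theorem continuous [CompleteSpace E] (hH : IsExpDecayHamiltonian T α ζ H Hm) (hζ : 0 < ζ) :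
    Continuous H := by
  have h : H = fun t => ∑' m, phase T (-m) t • Hm m :=
    funext fun t => (hH.hasSum_phase t).tsum_eq.symm
  rw [h]
  refine continuous_tsum (fun m => by fun_prop) (hH.summable_norm hζ) fun m t => ?_
  rw [norm_smul, norm_phase, one_mul]

theorem apply_add_period (hH : IsExpDecayHamiltonian T α ζ H Hm) (hT : 0 < T) (t : ℝ) :
    H (t + T) = H t := by
  refine (hH.hasSum_phase (t + T)).unique ?_
  simpa only [phase_add_period hT.ne'] using hH.hasSum_phase t

/-- Hermiticity of `H(t)` gives two Fourier series for `⟨u, H(t) v⟩`; uniqueness of coefficients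
yields `Hₘ* = H₋ₘ`. -/
theorem inner_component_left (hH : IsExpDecayHamiltonian T α ζ H Hm) (hζ : 0 < ζ) (hT : 0 < T)
    (m : ℤ) (u v : E) : inner ℂ (Hm m u) v = inner ℂ u (Hm (-m) v) := by
  have hsum : Summable fun m => ‖Hm m‖ * (‖u‖ * ‖v‖) := (hH.summable_norm hζ).mul_right _
  have h1 : ∀ t, HasSum (fun m : ℤ => phase T (-m) t • inner ℂ u (Hm m v))
      (inner ℂ u (H t v)) := by
    intro t
    have := (((hH.hasSum_phase t).mapL (ContinuousLinearMap.apply ℂ E v)).mapL (innerSL ℂ u))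
    simpa [inner_smul_right] using this
  have h2 : ∀ t, HasSum (fun m : ℤ => phase T (-m) t • inner ℂ (Hm (-m) u) v)
      (inner ℂ u (H t v)) := by
    intro t
    have h3 := (((hH.hasSum_phase t).mapL (ContinuousLinearMap.apply ℂ E u)).mapL
      (innerSL ℂ v)).star
    rw [← (Equiv.neg ℤ).hasSum_iff] at h3
    have h4 : inner ℂ u (H t v) = inner ℂ (H t u) v := (hH.hermitian t u v).symm
    rw [h4]
    simpa [Function.comp_def, inner_smul_right, conj_phase] using h3
  have e1 := hasSum_fourierComponent (T := T) (l := -m) (fun m => by fun_prop) hsum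
    (fun m t => by
      rw [norm_smul, norm_phase, one_mul]
      refine (norm_inner_le_norm _ _).trans ?_
      have := (Hm m).le_opNorm v
      calc ‖u‖ * ‖Hm m v‖ ≤ ‖u‖ * (‖Hm m‖ * ‖v‖) := by gcongr
        _ = _ := by ring) h1
  have e2 := hasSum_fourierComponent (T := T) (l := -m) (fun m => by fun_prop)
    (hsum.comp_injective neg_injective)
    (fun m t => by
      rw [norm_smul, norm_phase, one_mul]
      refine (norm_inner_le_norm _ _).trans ?_
      have := (Hm (-m)).le_opNorm u
      calc ‖Hm (-m) u‖ * ‖v‖ ≤ ‖Hm (-m)‖ * ‖u‖ * ‖v‖ := by gcongr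
        _ = _ := by simp only [Function.comp_apply]; ring) h2
  simp only [fourierComponent_phase_smul_const hT] at e1 e2
  have f1 := hasSum_single (f := fun k => if -m = k then inner ℂ u (Hm k v) else 0) (-m)
    (fun k hk => if_neg (Ne.symm hk))
  have f2 := hasSum_single (f := fun k => if -m = k then inner ℂ (Hm (-k) u) v else 0) (-m)
    (fun k hk => if_neg (Ne.symm hk))
  rw [if_pos rfl] at f1 f2
  rw [← e1.unique f1, e2.unique f2, neg_neg]

end IsExpDecayHamiltonian

namespace IsFloquetEigenstate

variable {ε : ℝ} {φ : ℝ → E}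

theorem hasDerivAt (hφ : IsFloquetEigenstate T H ε φ) (t : ℝ) :
    HasDerivAt φ ((Complex.I * ε) • φ t + (-Complex.I) • H t (φ t)) t := by
  have he : HasDerivAt (fun s : ℝ => Complex.exp (Complex.I * (ε * s : ℝ)))
      (Complex.exp (Complex.I * (ε * t : ℝ)) * (Complex.I * ε)) t := by
    have h := (((hasDerivAt_id t).const_mul ε).ofReal_comp.const_mul Complex.I).cexp
    refine h.congr_deriv ?_
    simp
  have hcancel : ∀ s : ℝ,
      Complex.exp (Complex.I * (ε * s : ℝ)) * Complex.exp (-(Complex.I * (ε * s : ℝ))) = 1 := by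
    intro s
    rw [← Complex.exp_add, add_neg_cancel, Complex.exp_zero]
  have h := he.smul (hφ.schrodinger t)
  have hfun : ((fun s : ℝ => Complex.exp (Complex.I * (ε * s : ℝ))) •
      fun s : ℝ => Complex.exp (-(Complex.I * (ε * s : ℝ))) • φ s) = φ := by
    funext s
    simp only [Pi.smul_apply', smul_smul, hcancel, one_smul]
  rw [hfun] at h
  refine h.congr_deriv ?_
  rw [map_smul, smul_neg, smul_comm Complex.I, smul_smul, smul_smul, hcancel, one_mul,
    smul_smul, mul_right_comm, hcancel, one_mul, neg_smul, add_comm]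

protected theorem continuous (hφ : IsFloquetEigenstate T H ε φ) : Continuous φ :=
  continuous_iff_continuousAt.2 fun t => (hφ.hasDerivAt t).continuousAt

variable [FiniteDimensional ℂ E]

/-- The eigenvalue equation of a Floquet eigenstate in Sambe space. -/
theorem hasSum_component (hφ : IsFloquetEigenstate T H ε φ)
    (hH : IsExpDecayHamiltonian T α ζ H Hm) (hζ : 0 < ζ) (hT : 0 < T) (l : ℤ) :
    HasSum (fun m => Hm m (fourierComponent T φ (l - m)))
      (((ε + l * freq T : ℝ) : ℂ) • fourierComponent T φ l) := by
  have : CompleteSpace E := FiniteDimensional.complete ℂ E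
  have hc := hφ.continuous
  have hHc := hH.continuous hζ
  have hHφ : Continuous fun t => H t (φ t) := hHc.clm_apply hc
  have h1 := fourierComponent_deriv hT hφ.hasDerivAt (by fun_prop) hφ.periodic l
  rw [fourierComponent_add (by fun_prop) (by fun_prop), fourierComponent_const_smul,
    fourierComponent_const_smul] at h1
  have h2 : fourierComponent T (fun t => H t (φ t)) l =
      ((ε + l * freq T : ℝ) : ℂ) • fourierComponent T φ l := by
    have h3 : (-Complex.I) • fourierComponent T (fun t => H t (φ t)) l =
        (-Complex.I) • (((ε + l * freq T : ℝ) : ℂ) • fourierComponent T φ l) := by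
      rw [eq_sub_of_add_eq' h1, smul_smul, ← neg_smul, ← sub_smul]
      congr 1; push_cast; ring
    exact smul_right_injective E (neg_ne_zero.2 Complex.I_ne_zero) h3
  rw [← h2]
  have h4 := hasSum_fourierComponent (T := T) (l := l)
    (f := fun m t => phase T (-m) t • Hm m (φ t)) (fun m => by fun_prop) (hH.summable_norm hζ)
    (fun m t => by
      rw [norm_smul, norm_phase, one_mul]
      simpa [hφ.norm_eq_one] using (Hm m).le_opNorm (φ t))
    (fun t => by simpa using (hH.hasSum_phase t).mapL (ContinuousLinearMap.apply ℂ E (φ t)))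
  simpa only [fourierComponent_phase_smul, fourierComponent_clm _ hc] using h4

theorem hasSum_norm_sq (hφ : IsFloquetEigenstate T H ε φ) (hT : 0 < T) :
    HasSum (fun l => ‖fourierComponent T φ l‖ ^ 2) 1 := by
  have h := hasSum_norm_fourierComponent_sq hT hφ.continuous
  simpa [hφ.norm_eq_one, hT.ne'] using h

end IsFloquetEigenstate

theorem norm_le_tsum_of_hasSum_component (hH : IsExpDecayHamiltonian T α ζ H Hm) {x : ℤ → E}
    {v : E} {l : ℤ} (h : HasSum (fun m => Hm m (x (l - m))) v)
    (hs : Summable fun m : ℤ => Real.exp (-(4 * (1 / (4 * ζ)) * |(m : ℝ)|)) * ‖x (l - m)‖) :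
    ‖v‖ ≤ α * ∑' m : ℤ, Real.exp (-(4 * (1 / (4 * ζ)) * |(m : ℝ)|)) * ‖x (l - m)‖ := by
  rw [← tsum_mul_left]
  refine h.norm_le_of_bounded (hs.mul_left α).hasSum fun m => ?_
  refine ((Hm m).le_opNorm _).trans ?_
  rw [← mul_assoc]
  exact mul_le_mul_of_nonneg_right (hH.norm_le_exp m) (norm_nonneg _)

/-- A square-summable solution of the eigenvalue equation in (possibly truncated) Sambe space is
weakly coupled. -/
theorem isWeaklyCoupled_of_hasSum (hH : IsExpDecayHamiltonian T α ζ H Hm) (hζ : 0 < ζ)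
    (hT : 0 < T) {x : ℤ → E} (hx : HasSum (fun l => ‖x l‖ ^ 2) 1) {ε κ : ℝ} (hα : 0 ≤ α)
    (hε : |ε| ≤ κ * freq T)
    -- The first alternative covers sites outside the truncation window, where the equation fails
    -- but the inequality is trivial.
    (h : ∀ l, x l = 0 ∨
      HasSum (fun m => Hm m (x (l - m))) (((ε + l * freq T : ℝ) : ℂ) • x l)) :
    IsWeaklyCoupled (1 / (4 * ζ)) (α / freq T) κ fun l => ‖x l‖ where
  nonneg l := norm_nonneg _
  summable_sq := hx.summable
  tsum_sq_le := hx.tsum_eq.le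
  le_convolution l := by
    have hω := freq_pos hT
    have hs := (convolution_quadratic_form_le (w := fun m : ℤ =>
      Real.exp (-(4 * (1 / (4 * ζ)) * |(m : ℝ)|))) (y := fun l => ‖x l‖)
      (fun m => (Real.exp_pos _).le) (fun l => norm_nonneg _)
      (summable_exp_neg_abs (s := 4 * (1 / (4 * ζ))) (by positivity)) hx.summable).1 l
    rcases h l with h0 | h0
    · rw [h0, norm_zero, mul_zero]
      exact mul_nonneg (by positivity) (tsum_nonneg fun m => by positivity)
    · have h1 := norm_le_tsum_of_hasSum_component hH h0 hs
      rw [norm_smul, Complex.norm_real, Real.norm_eq_abs] at h1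
      have h2 : (|(l : ℝ)| - κ) * freq T ≤ |ε + l * freq T| := by
        have := abs_sub_abs_le_abs_sub (l * freq T) (-ε)
        rw [abs_mul, abs_neg, abs_of_pos hω, sub_neg_eq_add, add_comm (_ * _)] at this
        linarith
      rw [div_mul_eq_mul_div, le_div_iff₀ hω]
      have := mul_le_mul_of_nonneg_right h2 (norm_nonneg (x l))
      linarith

theorem abs_le_of_mem_brillouinZone {ε : ℝ} (h : ε ∈ brillouinZone T) :
    |ε| ≤ 1 / 2 * freq T := by
  obtain ⟨h1, h2⟩ := h
  rw [abs_le]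
  constructor <;> linarith

theorem IsFloquetEigenstate.isWeaklyCoupled [FiniteDimensional ℂ E] {ε : ℝ} {φ : ℝ → E}
    (hφ : IsFloquetEigenstate T H ε φ) (hH : IsExpDecayHamiltonian T α ζ H Hm) (hζ : 0 < ζ)
    (hT : 0 < T) (hα : 0 ≤ α) (hε : ε ∈ brillouinZone T) :
    IsWeaklyCoupled (1 / (4 * ζ)) (α / freq T) (1 / 2) fun l => ‖fourierComponent T φ l‖ :=
  isWeaklyCoupled_of_hasSum hH hζ hT (hφ.hasSum_norm_sq hT) hα (abs_le_of_mem_brillouinZone hε)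
    fun l => Or.inr (hφ.hasSum_component hH hζ hT l)

/-- Exponential tails of Floquet eigenstates. -/
theorem IsFloquetEigenstate.norm_fourierComponent_le [FiniteDimensional ℂ E] {ε : ℝ} {φ : ℝ → E}
    (hφ : IsFloquetEigenstate T H ε φ) (hH : IsExpDecayHamiltonian T α ζ H Hm) (hζ : 0 < ζ)
    (hT : 0 < T) (hα : 0 ≤ α) (hε : ε ∈ brillouinZone T) (l : ℤ) :
    ‖fourierComponent T φ l‖ ≤ Real.exp (-((|(l : ℝ)| - 1 / 2) / (4 * ζ)) +
      coth (1 / (4 * ζ)) / (8 * Real.pi * ζ) * (α * T)) := by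
  have hω := freq_pos hT
  refine ((hφ.isWeaklyCoupled hH hζ hT hα hε).le_exp (by positivity) (by positivity) l).trans_eq ?_
  congr 1
  unfold freq
  field_simp
  ring

end

/-! ### The truncated Floquet Hamiltonian -/

/-- A constant for which a cutoff `L ≥ C (αT + log (1 / δ))` is sufficient. -/
def cutoffConst (s : ℝ) : ℝ :=
  2 * (2 * (4 * coth (s / 4) ^ 3 * Real.exp s) + s * coth (s / 4) + 1) / s

section numeric

variable {s : ℝ}

theorem cutoffConst_pos (hs : 0 < s) : 0 < cutoffConst s := by
  have := one_le_coth (show 0 < s / 4 by positivity)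
  unfold cutoffConst
  positivity

/-- Here `2πβ = αT`. The factor `2 / s` in `cutoffConst` cancels the rate `s / 2`, and the summand
`1` leaves room for `log (1 / δ)`. -/
theorem exp_cutoff_le (hs : 0 < s) {β δ L : ℝ} (hβ : 0 ≤ β) (hδ : 0 < δ) (hδ1 : δ < 1)
    (hL : cutoffConst s * (2 * Real.pi * β + Real.log (1 / δ)) ≤ L) :
    Real.exp (-(s / 2 * L)) ≤
      δ * Real.exp (-((2 * (4 * coth (s / 4) ^ 3 * Real.exp s) + s * coth (s / 4)) * β)) := by
  have hR := one_le_coth (show 0 < s / 4 by positivity)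
  set M := 2 * (4 * coth (s / 4) ^ 3 * Real.exp s) + s * coth (s / 4) with hM
  have hM0 : 0 ≤ M := by positivity
  have hlog : 0 ≤ Real.log (1 / δ) := Real.log_nonneg (by rw [le_div_iff₀ hδ]; linarith)
  have h1 : (M + 1) * (2 * Real.pi * β + Real.log (1 / δ)) ≤ s / 2 * L := by
    have := mul_le_mul_of_nonneg_left hL (show 0 ≤ s / 2 by positivity)
    refine le_trans (le_of_eq ?_) this
    unfold cutoffConst
    rw [← hM]
    field_simp
  have h2 : M * β + Real.log (1 / δ) ≤ s / 2 * L := by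
    refine le_trans ?_ h1
    have hpi : β ≤ 2 * Real.pi * β := by nlinarith [Real.pi_gt_three]
    nlinarith [mul_nonneg hM0 hlog, mul_nonneg hM0 hβ, mul_le_mul_of_nonneg_left hpi hM0]
  calc Real.exp (-(s / 2 * L)) ≤ Real.exp (Real.log δ + -(M * β)) := by
        apply Real.exp_le_exp.2
        rw [one_div, Real.log_inv] at h2
        linarith
    _ = _ := by rw [Real.exp_add, Real.exp_log hδ]

/-- The cutoff condition has no additive constant, so for small `β` and `δ` near `1` the factor
`e^{-sL/2}` need not be small. Smallness then comes from the powers of `β`; for large `β` each power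
is absorbed into `e^{kβ}`. -/
theorem cutoff_bounds (hs : 0 < s) {β δ L : ℝ} (hβ : 0 ≤ β) (hδ : 0 < δ) (hδ1 : δ < 1)
    (hL : cutoffConst s * (2 * Real.pi * β + Real.log (1 / δ)) ≤ L) {P : ℝ}
    (hP : P ≤ coth (s / 4) * Real.exp (s * (1 + β * coth (s / 4)))) (hP0 : 0 ≤ P) :
    β * P * coth (s / 4) * Real.exp (-(s / 2 * L)) ≤ δ / 4 ∧
      β * (2 * β * P) * coth (s / 4) ^ 2 * Real.exp (-(s / 2 * L)) ≤ δ / 2 := by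
  have hE := exp_cutoff_le hs hβ hδ hδ1 hL
  have hR := one_le_coth (show 0 < s / 4 by positivity)
  set R := coth (s / 4) with hRdef
  set k := 4 * R ^ 3 * Real.exp s with hk
  have hes : 1 ≤ Real.exp s := Real.one_le_exp hs.le
  have hR2 : 1 ≤ R ^ 2 := one_le_pow₀ hR
  have hR3 : 1 ≤ R ^ 3 := one_le_pow₀ hR
  have hk4 : 4 ≤ k := by rw [hk]; nlinarith
  have hβk : k * β ≤ Real.exp (k * β) := by linarith [Real.add_one_le_exp (k * β)]
  have hkβ0 : 0 ≤ k * β := by positivity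
  set X := Real.exp (k * β) with hX
  have hX1 : 1 ≤ X := Real.one_le_exp hkβ0
  set E := Real.exp (-(s / 2 * L)) with hEdef
  have hE0 : 0 ≤ E := (Real.exp_pos _).le
  have hexp : X ^ 2 * Real.exp (s * (β * R)) * E ≤ δ := by
    have e : X ^ 2 * Real.exp (s * (β * R)) = Real.exp ((2 * k + s * R) * β) := by
      rw [hX, ← Real.exp_nat_mul, ← Real.exp_add]; congr 1; push_cast; ring
    rw [e]
    calc Real.exp ((2 * k + s * R) * β) * E
        ≤ Real.exp ((2 * k + s * R) * β) * (δ * Real.exp (-((2 * k + s * R) * β))) := by gcongr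
      _ = δ := by
        rw [mul_left_comm, ← Real.exp_add, add_neg_cancel, Real.exp_zero, mul_one]
  set Y := Real.exp (s * (β * R)) with hY
  have hY0 : 0 < Y := Real.exp_pos _
  have hP' : P ≤ R * Real.exp s * Y := by
    refine hP.trans_eq ?_
    rw [mul_add, mul_one, Real.exp_add]; ring
  -- The choice `k = 4 R³ eˢ` turns the constant prefactor into a gain of `1/4`.
  have hA : R * (k * β * R) * Real.exp s ≤ k / 4 * X := by
    calc R * (k * β * R) * Real.exp s = (R ^ 2 * Real.exp s) * (k * β) := by ring
      _ ≤ (R ^ 3 * Real.exp s) * X := by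
        gcongr
        · norm_num
      _ = k / 4 * X := by rw [hk]; ring
  have hk0 : 0 < k := by linarith
  have hA' : β * P * R ≤ X / 4 * Y := by
    have h1 : β * P * R ≤ β * (R * Real.exp s * Y) * R := by gcongr
    have h2 : k * (β * (R * Real.exp s * Y) * R) ≤ k * (X / 4 * Y) := by
      have := mul_le_mul_of_nonneg_right hA hY0.le
      nlinarith
    exact h1.trans (le_of_mul_le_mul_left h2 hk0)
  constructor
  · calc β * P * R * E ≤ X / 4 * Y * E := by gcongr
      _ ≤ X ^ 2 / 4 * Y * E := by gcongr; nlinarith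
      _ = (X ^ 2 * Y * E) / 4 := by ring
      _ ≤ δ / 4 := by gcongr
  · have hβR : β * R ≤ X := by
      have h3 : R ≤ k := by
        rw [hk]
        have : R ≤ R ^ 3 := le_self_pow₀ hR (by norm_num)
        nlinarith
      calc β * R ≤ β * k := by gcongr
        _ ≤ X := by rw [mul_comm]; exact hβk
    calc β * (2 * β * P) * R ^ 2 * E = 2 * (β * R) * (β * P * R) * E := by ring
      _ ≤ 2 * X * (X / 4 * Y) * E := by gcongr
      _ = (X ^ 2 * Y * E) / 2 := by ring
      _ ≤ δ / 2 := by gcongr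

/-- The prefactor in the decay estimate of a weakly coupled sequence. -/
theorem decay_prefactor_le (hs : 0 < s) {β κ : ℝ} (hβ : 0 ≤ β) (hκ : κ ≤ 1) :
    coth s * Real.exp (s * (κ + β * coth s)) ≤
      coth (s / 4) * Real.exp (s * (1 + β * coth (s / 4))) := by
  have h1 := coth_le_coth (show 0 < s / 4 by positivity) (show s / 4 ≤ s by linarith)
  have h2 := one_le_coth hs
  have h3 : 0 ≤ coth (s / 4) := by linarith
  gcongr

theorem tsum_exp_neg_half (hs : 0 < s) :
    HasSum (fun m : ℤ => Real.exp (-(s / 2 * |(m : ℝ)|))) (coth (s / 4)) := by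
  have h := hasSum_exp_neg_abs (show 0 < s / 4 by positivity)
  have e : 2 * (s / 4) = s / 2 := by ring
  rwa [e] at h

/-- Outside of the cutoff, half of the decay rate can be traded for a small factor. -/
theorem exp_neg_le_of_le_abs (hs : 0 < s) {L a : ℝ} (h : L ≤ a) :
    Real.exp (-(s * a)) ≤ Real.exp (-(s / 2 * L)) * Real.exp (-(s / 2 * a)) := by
  rw [← Real.exp_add]
  apply Real.exp_le_exp.2
  nlinarith

end numeric

theorem norm_le_of_norm_apply_le {E : Type*} [NormedAddCommGroup E] {ζ : ℝ} (hζ : 0 < ζ) {L : ℕ}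
    {Ψ : TruncSambe E L} {B : ℝ} (hB : 0 ≤ B)
    (h : ∀ l : TruncIndex L, ‖Ψ l‖ ≤ B * Real.exp (-(1 / (4 * ζ) / 2 * |((l : ℤ) : ℝ)|))) :
    ‖Ψ‖ ≤ B * coth (1 / (4 * ζ) / 4) := by
  have hR := tsum_exp_neg_half (s := 1 / (4 * ζ)) (by positivity)
  have h1 : ‖Ψ‖ ≤ ∑ l, ‖Ψ l‖ := by
    refine le_of_sq_le_sq ?_ (Finset.sum_nonneg fun _ _ => norm_nonneg _)
    rw [PiLp.norm_sq_eq_of_L2]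
    exact Finset.sum_sq_le_sq_sum_of_nonneg fun _ _ => norm_nonneg _
  refine h1.trans ((Finset.sum_le_sum fun l _ => h l).trans ?_)
  rw [← Finset.mul_sum]
  refine mul_le_mul_of_nonneg_left ?_ hB
  rw [Finset.sum_coe_sort (Finset.Ioc (-(L : ℤ)) (L : ℤ))
    (fun l : ℤ => Real.exp (-(1 / (4 * ζ) / 2 * |(l : ℝ)|))), ← hR.tsum_eq]
  exact hR.summable.sum_le_tsum _ fun _ _ => (Real.exp_pos _).le

section

variable {E : Type*} [NormedAddCommGroup E] [InnerProductSpace ℂ E]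
  {T α ζ : ℝ} {H : ℝ → E →L[ℂ] E} {Hm : ℤ → E →L[ℂ] E} {L : ℕ}

/-- The window omits `-L`, so `L` rather than `L + 1` is the sharp bound. -/
theorem le_abs_of_notMem_Ioc {l : ℤ} (h : l ∉ Finset.Ioc (-(L : ℤ)) (L : ℤ)) :
    (L : ℝ) ≤ |(l : ℝ)| := by
  have : (L : ℤ) ≤ |l| := by
    rw [Finset.mem_Ioc, not_and_or, not_lt, not_le] at h
    rcases h with h | h
    · rw [le_abs]; right; omega
    · rw [le_abs]; left; omega
  exact_mod_cast this

@[simp]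
theorem truncFloquetHamiltonian_apply (Ψ : TruncSambe E L) (l : TruncIndex L) :
    truncFloquetHamiltonian T Hm L Ψ l =
      (∑ l' : TruncIndex L, Hm ((l : ℤ) - (l' : ℤ)) (Ψ l')) -
        ((((l : ℤ) : ℝ) * freq T : ℝ) : ℂ) • Ψ l := rfl

theorem isSymmetric_truncFloquetHamiltonian (hH : IsExpDecayHamiltonian T α ζ H Hm) (hζ : 0 < ζ)
    (hT : 0 < T) (L : ℕ) : (truncFloquetHamiltonian T Hm L).IsSymmetric := by
  intro Ψ Φ
  simp only [PiLp.inner_apply, truncFloquetHamiltonian_apply, inner_sub_left, inner_sub_right,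
    sum_inner, inner_sum, Finset.sum_sub_distrib, inner_smul_left, inner_smul_right,
    Complex.conj_ofReal]
  congr 1
  rw [Finset.sum_comm]
  refine Finset.sum_congr rfl fun l _ => Finset.sum_congr rfl fun l' _ => ?_
  rw [hH.inner_component_left hζ hT, neg_sub]

/-- Extension of a truncated Sambe vector by zero. -/
def extendZero (Ψ : TruncSambe E L) (l : ℤ) : E :=
  if h : l ∈ Finset.Ioc (-(L : ℤ)) (L : ℤ) then Ψ ⟨l, h⟩ else 0

theorem hasSum_extendZero (Hm : ℤ → E →L[ℂ] E) (Ψ : TruncSambe E L) (l : ℤ) :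
    HasSum (fun m => Hm m (extendZero Ψ (l - m)))
      (∑ l' : TruncIndex L, Hm (l - (l' : ℤ)) (Ψ l')) := by
  have h : ∑ l' : TruncIndex L, Hm (l - (l' : ℤ)) (Ψ l') =
      ∑ k ∈ Finset.Ioc (-(L : ℤ)) (L : ℤ), Hm (l - k) (extendZero Ψ k) := by
    rw [← Finset.sum_coe_sort (Finset.Ioc (-(L : ℤ)) (L : ℤ))]
    refine Finset.sum_congr rfl fun k _ => ?_
    have hk := k.2
    simp [extendZero, hk]
  rw [h, ← (Equiv.subLeft l).hasSum_iff]
  simp only [Function.comp_def, Equiv.subLeft_apply, sub_sub_cancel]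
  refine hasSum_sum_of_ne_finset_zero fun k hk => ?_
  rw [extendZero, dif_neg hk, map_zero]

/-- The kernel decays at rate `4s`, faster than the sequence's `s/2`, so the convolution keeps the
slower rate at the cost of a factor `α coth (s/4)`. -/
theorem norm_le_of_hasSum_component (hH : IsExpDecayHamiltonian T α ζ H Hm) (hζ : 0 < ζ)
    (hα : 0 ≤ α) {y : ℤ → E} {B : ℝ}
    (hy : ∀ k : ℤ, ‖y k‖ ≤ B * Real.exp (-(1 / (4 * ζ) / 2 * |(k : ℝ)|))) {l : ℤ} {v : E}
    (hv : HasSum (fun m => Hm m (y (l - m))) v) :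
    ‖v‖ ≤ α * (B * coth (1 / (4 * ζ) / 4)) * Real.exp (-(1 / (4 * ζ) / 2 * |(l : ℝ)|)) := by
  set s := 1 / (4 * ζ) with hsdef
  have hs : 0 < s := by positivity
  have hB : 0 ≤ B := by
    have := (norm_nonneg _).trans (hy 0)
    simpa using this
  have hR := tsum_exp_neg_half hs
  have hle : ∀ m : ℤ, Real.exp (-(4 * s * |(m : ℝ)|)) * ‖y (l - m)‖ ≤
      Real.exp (-(s / 2 * |(m : ℝ)|)) * (B * Real.exp (-(s / 2 * |(l : ℝ)|))) := by
    intro m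
    calc Real.exp (-(4 * s * |(m : ℝ)|)) * ‖y (l - m)‖
        ≤ Real.exp (-(4 * s * |(m : ℝ)|)) *
            (B * Real.exp (-(s / 2 * |((l - m : ℤ) : ℝ)|))) := by gcongr; exact hy _
      _ = B * Real.exp (-(4 * s * |(m : ℝ)|) + -(s / 2 * |((l - m : ℤ) : ℝ)|)) := by
          rw [Real.exp_add]; ring
      _ ≤ B * Real.exp (-(s / 2 * |(m : ℝ)|) + -(s / 2 * |(l : ℝ)|)) := by
          gcongr B * Real.exp ?_
          have h : |(l : ℝ)| ≤ |((l - m : ℤ) : ℝ)| + |(m : ℝ)| := by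
            have := abs_add_le ((l - m : ℤ) : ℝ) (m : ℝ)
            simpa using this
          have := mul_le_mul_of_nonneg_left h hs.le
          nlinarith [mul_nonneg hs.le (abs_nonneg (m : ℝ))]
      _ = _ := by rw [Real.exp_add]; ring
  have hsum : Summable fun m : ℤ => Real.exp (-(4 * s * |(m : ℝ)|)) * ‖y (l - m)‖ :=
    Summable.of_nonneg_of_le (fun m => by positivity) hle (hR.summable.mul_right _)
  refine (norm_le_tsum_of_hasSum_component hH hv hsum).trans ?_
  have := hsum.tsum_le_tsum hle (hR.summable.mul_right _)
  rw [tsum_mul_right, hR.tsum_eq] at this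
  calc _ ≤ α * (coth (s / 4) * (B * Real.exp (-(s / 2 * |(l : ℝ)|)))) := by gcongr
    _ = _ := by ring

end

/-! ### From quasienergies to eigenvalues of the truncation -/

section

variable {E : Type*} [NormedAddCommGroup E] [InnerProductSpace ℂ E] [FiniteDimensional ℂ E]
  {T α ζ : ℝ} {H : ℝ → E →L[ℂ] E} {Hm : ℤ → E →L[ℂ] E} {L : ℕ} {ε : ℝ} {φ : ℝ → E}

/-- Away from the origin, the Fourier components of a Floquet eigenstate are of order `αT`. -/
theorem IsFloquetEigenstate.norm_fourierComponent_le_mul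
    (hφ : IsFloquetEigenstate T H ε φ) (hH : IsExpDecayHamiltonian T α ζ H Hm) (hζ : 0 < ζ)
    (hT : 0 < T) (hα : 0 ≤ α) (hε : ε ∈ brillouinZone T) {l : ℤ} (hl : 1 ≤ |(l : ℝ)|) :
    ‖fourierComponent T φ l‖ ≤ 2 * (α / freq T) * (coth (1 / (4 * ζ)) *
      Real.exp (1 / (4 * ζ) * (1 / 2 + α / freq T * coth (1 / (4 * ζ))))) *
        Real.exp (-(1 / (4 * ζ) * |(l : ℝ)|)) := by
  have hω := freq_pos hT
  have hx := hφ.isWeaklyCoupled hH hζ hT hα hε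
  have h1 := hx.le_convolution l
  have h2 := mul_le_mul_of_nonneg_left
    (hx.convolution_le (by positivity) (by positivity) l) (show 0 ≤ α / freq T by positivity)
  -- The convolution bound is fed back into the defining inequality; dividing by `|l| - 1/2 ≥ 1/2`
  -- gives the factor `2β` that `cutoff_bounds` needs.
  have h3 : 1 / 2 * ‖fourierComponent T φ l‖ ≤ (|(l : ℝ)| - 1 / 2) * ‖fourierComponent T φ l‖ :=
    mul_le_mul_of_nonneg_right (by linarith) (norm_nonneg _)
  linarith

/-- Every quasienergy is close to an eigenvalue of the truncated Floquet Hamiltonian. -/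
theorem IsFloquetEigenstate.exists_hasEigenvalue
    (hφ : IsFloquetEigenstate T H ε φ) (hH : IsExpDecayHamiltonian T α ζ H Hm) (hζ : 0 < ζ)
    (hT : 0 < T) (hα : 0 ≤ α) (hε : ε ∈ brillouinZone T) (hL1 : 1 ≤ L) {δ : ℝ} (hδ : 0 < δ)
    (hδ1 : δ < 1)
    (hL : cutoffConst (1 / (4 * ζ)) * (2 * Real.pi * (α / freq T) + Real.log (1 / δ)) ≤ L) :
    ∃ ε' : ℝ, Module.End.HasEigenvalue (truncFloquetHamiltonian T Hm L) (ε' : ℂ) ∧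
      |ε' - ε| / freq T ≤ δ := by
  have hω := freq_pos hT
  set s := 1 / (4 * ζ) with hsdef
  have hs : 0 < s := by positivity
  set β := α / freq T with hβdef
  have hβ : 0 ≤ β := by positivity
  have hR1 := one_le_coth (show 0 < s / 4 by positivity)
  set R := coth (s / 4) with hRdef
  set P := coth s * Real.exp (s * (1 / 2 + β * coth s)) with hPdef
  have hP0 : 0 ≤ P := mul_nonneg (zero_le_one.trans (one_le_coth hs)) (Real.exp_pos _).le
  have hPle : P ≤ R * Real.exp (s * (1 + β * R)) :=
    decay_prefactor_le hs hβ (by norm_num)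
  obtain ⟨b1, b2⟩ := cutoff_bounds hs hβ hδ hδ1 hL hPle hP0
  set e0 := Real.exp (-(s / 2 * L)) with he0
  have he0pos : 0 < e0 := Real.exp_pos _
  set D := 2 * β * P with hD
  have hD0 : 0 ≤ D := by positivity
  set W := Finset.Ioc (-(L : ℤ)) (L : ℤ) with hW
  set x : ℤ → E := fourierComponent T φ with hx
  set y : ℤ → E := fun l => if l ∈ W then 0 else x l with hy
  set Ψ : TruncSambe E L := WithLp.toLp 2 fun l : TruncIndex L => x l with hΨ
  have hext : ∀ l, extendZero Ψ l = x l - y l := by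
    intro l
    by_cases hl : l ∈ W
    · simp [extendZero, hy, hl, hW ▸ hl, hΨ]
    · simp [extendZero, hy, hl, hW ▸ hl]
  have hyle : ∀ k : ℤ, ‖y k‖ ≤ D * e0 * Real.exp (-(s / 2 * |(k : ℝ)|)) := by
    intro k
    by_cases hk : k ∈ W
    · simp only [hy, if_pos hk, norm_zero]; positivity
    · have hLk := le_abs_of_notMem_Ioc hk
      have h1 : (1 : ℝ) ≤ |(k : ℝ)| := le_trans (by exact_mod_cast hL1) hLk
      simp only [hy, if_neg hk]
      refine (hφ.norm_fourierComponent_le_mul hH hζ hT hα hε h1).trans ?_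
      rw [mul_assoc D]
      exact mul_le_mul_of_nonneg_left (exp_neg_le_of_le_abs hs hLk) hD0
  -- Subtracting the truncated equation from the full one leaves, up to sign, only the convolution
  -- with the discarded tail `y`.
  have hres : ‖truncFloquetHamiltonian T Hm L Ψ - (ε : ℂ) • Ψ‖ ≤
      α * (D * e0 * R) * R := by
    refine norm_le_of_norm_apply_le hζ (by positivity) fun l => ?_
    rw [← norm_neg]
    refine norm_le_of_hasSum_component hH hζ hα hyle (l := l) ?_
    have h1 := hφ.hasSum_component hH hζ hT l
    have h2 := hasSum_extendZero Hm Ψ l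
    convert! h1.sub h2 using 1
    · funext m
      rw [hext, map_sub, sub_sub_cancel]
    · rw [PiLp.sub_apply, PiLp.smul_apply, truncFloquetHamiltonian_apply]
      have : Ψ l = x l := rfl
      rw [this]
      push_cast
      module
  -- The discarded mass is at most `(D e0)² R ≤ 1/4`.
  have hnorm : 1 / 2 ≤ ‖Ψ‖ := by
    have hsq : HasSum (fun l => ‖x l‖ ^ 2) 1 := hφ.hasSum_norm_sq hT
    have hΨsq : HasSum (fun l => ‖extendZero Ψ l‖ ^ 2) (‖Ψ‖ ^ 2) := by
      rw [PiLp.norm_sq_eq_of_L2]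
      have : ∑ l, ‖Ψ l‖ ^ 2 = ∑ l ∈ W, ‖extendZero Ψ l‖ ^ 2 := by
        rw [← Finset.sum_coe_sort W]
        refine Finset.sum_congr rfl fun k _ => ?_
        have hk := k.2
        simp [extendZero, hk]
      rw [this]
      refine hasSum_sum_of_ne_finset_zero fun k hk => ?_
      rw [extendZero, dif_neg hk]; simp
    have hR := tsum_exp_neg_half hs
    have h1 : ∀ l, ‖x l‖ ^ 2 ≤ ‖extendZero Ψ l‖ ^ 2 +
        (D * e0) ^ 2 * Real.exp (-(s / 2 * |(l : ℝ)|)) := by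
      intro l
      by_cases hl : l ∈ W
      · rw [hext]
        simp only [hy, if_pos hl, sub_zero]
        have : 0 ≤ (D * e0) ^ 2 * Real.exp (-(s / 2 * |(l : ℝ)|)) := by positivity
        linarith
      · have h2 := hyle l
        rw [hext]
        simp only [hy, if_neg hl, sub_self, norm_zero] at h2 ⊢
        have h3 := pow_le_pow_left₀ (norm_nonneg _) h2 2
        rw [mul_pow] at h3
        have h4 : Real.exp (-(s / 2 * |(l : ℝ)|)) ≤ 1 := Real.exp_le_one_iff.2 (by
          have := abs_nonneg (l : ℝ); nlinarith)
        have h5 : Real.exp (-(s / 2 * |(l : ℝ)|)) ^ 2 ≤ Real.exp (-(s / 2 * |(l : ℝ)|)) :=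
          pow_le_of_le_one (Real.exp_pos _).le h4 two_ne_zero
        have h6 := mul_le_mul_of_nonneg_left h5 (sq_nonneg (D * e0))
        simp only [ne_eq, OfNat.ofNat_ne_zero, not_false_eq_true, zero_pow, zero_add]
        linarith
    have h2 := hasSum_le h1 hsq (hΨsq.add (hR.mul_left _))
    have h3 : D * R * e0 ≤ 1 / 2 := by
      have : D * R * e0 = 2 * (β * P * R * e0) := by rw [hD]; ring
      rw [this]; linarith
    have h4 : (D * e0) ^ 2 * R ≤ 1 / 4 := by
      have h5 : (D * e0) ^ 2 * R ≤ (D * R * e0) ^ 2 := by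
        have : (D * R * e0) ^ 2 = (D * e0) ^ 2 * R * R := by ring
        rw [this]
        exact le_mul_of_one_le_right (by positivity) hR1
      have h6 : (D * R * e0) ^ 2 ≤ (1 / 2) ^ 2 := pow_le_pow_left₀ (by positivity) h3 2
      linarith
    nlinarith [norm_nonneg Ψ]
  have hres2 : ‖truncFloquetHamiltonian T Hm L Ψ - (ε : ℂ) • Ψ‖ ≤ (freq T * δ) * ‖Ψ‖ := by
    refine hres.trans ?_
    have h1 : α = freq T * β := by rw [hβdef]; field_simp
    calc α * (D * e0 * R) * R = freq T * (β * D * R ^ 2 * e0) := by rw [h1]; ring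
      _ ≤ freq T * (δ / 2) := by gcongr
      _ = freq T * δ * (1 / 2) := by ring
      _ ≤ _ := by gcongr
  have hsymm := isSymmetric_truncFloquetHamiltonian hH hζ hT L
  have hΨ0 : Ψ ≠ 0 := by
    intro h0
    rw [h0, norm_zero] at hnorm
    norm_num at hnorm
  obtain ⟨z, hz, hzle⟩ := exists_hasEigenvalue_near hsymm (fun v => rfl) hΨ0 hres2
  have hzre : ((z.re : ℝ) : ℂ) = z := Complex.conj_eq_iff_re.1 (hsymm.conj_eigenvalue_eq_self hz)
  refine ⟨z.re, by rwa [hzre], ?_⟩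
  rw [div_le_iff₀ hω, mul_comm]
  refine le_trans (le_of_eq ?_) hzle
  rw [← hzre, ← Complex.ofReal_sub, Complex.norm_real, Real.norm_eq_abs]
  simp

end

/-! ### The propagator -/

section

variable {E : Type*} [NormedAddCommGroup E] [InnerProductSpace ℂ E]

theorem hasDerivAt_clm_apply {A : ℝ → E →L[ℂ] E} {A' : E →L[ℂ] E} {f : ℝ → E}
    {f' : E} {t : ℝ} (hA : HasDerivAt A A' t) (hf : HasDerivAt f f' t) :
    HasDerivAt (fun t => A t (f t)) (A' (f t) + A t f') t :=
  ((ContinuousLinearMap.restrictScalarsL ℂ E E ℝ ℝ).hasFDerivAt.comp_hasDerivAt t hA).clm_apply hf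

variable [CompleteSpace E] {H : ℝ → E →L[ℂ] E}

theorem star_neg_I_smul {A : E →L[ℂ] E} (hA : (A : E →ₗ[ℂ] E).IsSymmetric) :
    star ((-Complex.I) • A) = -((-Complex.I) • A) := by
  have h : star A = A := hA.isSelfAdjoint
  rw [star_smul, h]
  simp

/-- `-iH` is skew-adjoint, so the derivative cancels. `V = U` gives unitarity; `V = U(· + T)` gives
Floquet's relation. -/
theorem star_mul_eq_const {U V : ℝ → E →L[ℂ] E}
    (hH : ∀ t, ((H t : E →L[ℂ] E) : E →ₗ[ℂ] E).IsSymmetric)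
    (hU : ∀ t, HasDerivAt U (((-Complex.I) • H t) * U t) t)
    (hV : ∀ t, HasDerivAt V (((-Complex.I) • H t) * V t) t) (t₀ t : ℝ) :
    star (U t) * V t = star (U t₀) * V t₀ := by
  have h : ∀ t, HasDerivAt (fun t => star (U t) * V t) 0 t := by
    intro t
    refine ((hU t).star.mul (hV t)).congr_deriv ?_
    rw [star_mul, star_neg_I_smul (hH t)]
    noncomm_ring
  exact is_const_of_deriv_eq_zero (fun t => (h t).differentiableAt) (fun t => (h t).deriv) t t₀

/-- The unitary propagator of a time-dependent Hamiltonian. -/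
theorem exists_unitary_propagator [FiniteDimensional ℂ E] (hc : Continuous H) {K : ℝ}
    (hK : ∀ t, ‖H t‖ ≤ K) (hH : ∀ t, ((H t : E →L[ℂ] E) : E →ₗ[ℂ] E).IsSymmetric) (t₀ : ℝ) :
    ∃ U : ℝ → E →L[ℂ] E, U t₀ = 1 ∧ (∀ t, HasDerivAt U (((-Complex.I) • H t) * U t) t) ∧
      (∀ t, star (U t) * U t = 1) ∧ ∀ t, U t * star (U t) = 1 := by
  obtain ⟨U, h0, hU⟩ := exists_propagator (B := fun t => (-Complex.I) • H t) t₀ (K := K)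
    (by fun_prop) (fun t => by rw [norm_smul, norm_neg, Complex.norm_I, one_mul]; exact hK t)
  have h1 : ∀ t, star (U t) * U t = 1 := by
    intro t
    rw [star_mul_eq_const hH hU hU t₀ t, h0, star_one, one_mul]
  refine ⟨U, h0, hU, h1, fun t => ?_⟩
  have h2 : ((star (U t) : E →L[ℂ] E) : E →ₗ[ℂ] E) * (U t : E →ₗ[ℂ] E) = 1 := by
    ext v
    exact congrArg (fun A : E →L[ℂ] E => A v) (h1 t)
  have h3 := mul_eq_one_comm.1 h2
  ext v
  exact congrArg (fun A : E →ₗ[ℂ] E => A v) h3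

theorem norm_apply_of_star_mul {M : E →L[ℂ] E} (h : star M * M = 1) (v : E) : ‖M v‖ = ‖v‖ := by
  have h1 : inner ℂ (M v) (M v) = inner ℂ v v := by
    rw [← ContinuousLinearMap.adjoint_inner_right]
    exact congrArg (fun A : E →L[ℂ] E => inner ℂ v (A v)) h
  rw [← sq_eq_sq₀ (norm_nonneg _) (norm_nonneg _), ← inner_self_eq_norm_sq (𝕜 := ℂ),
    ← inner_self_eq_norm_sq (𝕜 := ℂ), h1]

/-- Approximate solutions of the Schrödinger equation stay close to exact ones. -/
theorem norm_propagator_sub_le {U : ℝ → E →L[ℂ] E}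
    (hH : ∀ t, ((H t : E →L[ℂ] E) : E →ₗ[ℂ] E).IsSymmetric) {t₀ : ℝ} (h0 : U t₀ = 1)
    (hU : ∀ t, HasDerivAt U (((-Complex.I) • H t) * U t) t)
    (hl : ∀ t, star (U t) * U t = 1) (hr : ∀ t, U t * star (U t) = 1) {χ r : ℝ → E} {ρ : ℝ}
    (hχ : ∀ t, HasDerivAt χ (((-Complex.I) • H t) (χ t) + r t) t) (hρ : ∀ t, ‖r t‖ ≤ ρ)
    {T : ℝ} (hT : 0 ≤ T) : ‖U (t₀ + T) (χ t₀) - χ (t₀ + T)‖ ≤ ρ * T := by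
  -- In the interaction picture only the residual drives the motion, and `U*` preserves its norm.
  have hd : ∀ t, HasDerivAt (fun t => star (U t) (χ t)) (star (U t) (r t)) t := by
    intro t
    refine (hasDerivAt_clm_apply (hU t).star (hχ t)).congr_deriv ?_
    rw [star_mul, star_neg_I_smul (hH t), map_add]
    simp
  have hn : ∀ t v, ‖star (U t) v‖ = ‖v‖ := fun t v =>
    norm_apply_of_star_mul (by rw [star_star]; exact hr t) v
  have h1 := norm_image_sub_le_of_norm_deriv_le_segment' (a := t₀) (b := t₀ + T) (C := ρ)
    (fun t _ => (hd t).hasDerivWithinAt) (fun t _ => by rw [hn]; exact hρ t) (t₀ + T)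
    (Set.right_mem_Icc.2 (by linarith))
  rw [add_sub_cancel_left, h0, star_one] at h1
  rw [norm_sub_rev, ← hn (t₀ + T), map_sub]
  have h2 : star (U (t₀ + T)) (U (t₀ + T) (χ t₀)) = χ t₀ :=
    congrArg (fun A : E →L[ℂ] E => A (χ t₀)) (hl (t₀ + T))
  rw [h2]
  exact h1

end

/-! ### Monodromy eigenvalues and quasienergies -/

section

variable {E : Type*} [NormedAddCommGroup E] [InnerProductSpace ℂ E]
  {H : ℝ → E →L[ℂ] E} {T : ℝ}

theorem exists_mem_brillouinZone_exp_eq (hT : 0 < T) {z : ℂ} (hz : ‖z‖ = 1) :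
    ∃ ε ∈ brillouinZone T, Complex.exp (-(Complex.I * (ε * T : ℝ))) = z := by
  have hω := freq_pos hT
  refine ⟨toIcoMod hω (-(freq T / 2)) (-(z.arg / T)), ?_, ?_⟩
  · have h := toIcoMod_mem_Ico hω (-(freq T / 2)) (-(z.arg / T))
    unfold brillouinZone
    convert! h using 2
    ring
  · have h := self_sub_toIcoDiv_zsmul hω (-(freq T / 2)) (-(z.arg / T))
    rw [← h, zsmul_eq_mul]
    set n := toIcoDiv hω (-(freq T / 2)) (-(z.arg / T))
    have e : -(Complex.I * (((-(z.arg / T) - n * freq T) * T : ℝ) : ℂ)) =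
        z.arg * Complex.I + n * (2 * Real.pi * Complex.I) := by
      have h1 : (-(z.arg / T) - n * freq T) * T = -z.arg - n * (2 * Real.pi) := by
        rw [sub_mul, mul_assoc, freq_mul_period hT.ne']
        field_simp
      rw [h1]; push_cast; ring
    rw [e, Complex.exp_add, Complex.exp_int_mul_two_pi_mul_I, mul_one]
    have h2 := Complex.norm_mul_exp_arg_mul_I z
    rwa [hz, Complex.ofReal_one, one_mul] at h2

/-- With `w` the reduced residue, the chord has length `2 |sin (πw)|`, and Jordan's inequality
applies because `|w| ≤ 1/2`. -/
theorem abs_modOne_le (hT : 0 < T) {ε ε' : ℝ} :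
    4 * |modOne ((ε - ε') / freq T)| ≤ ‖Complex.exp (-(Complex.I * (ε * T : ℝ))) -
      Complex.exp (-(Complex.I * (ε' * T : ℝ)))‖ := by
  have hω := freq_pos hT
  set y := (ε - ε') / freq T with hy
  have hmem := toIcoMod_mem_Ico (zero_lt_one : (0 : ℝ) < 1) (-(1 / 2)) y
  have hdiv := self_sub_toIcoDiv_zsmul (zero_lt_one : (0 : ℝ) < 1) (-(1 / 2)) y
  change modOne y ∈ _ at hmem
  change _ = modOne y at hdiv
  set n := toIcoDiv (zero_lt_one : (0 : ℝ) < 1) (-(1 / 2)) y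
  set w := modOne y
  have hyw : y = w + n := by
    rw [← hdiv]; simp
  have hεT : ε * T = ε' * T + 2 * Real.pi * w + n * (2 * Real.pi) := by
    have h1 : ε = ε' + y * freq T := by rw [hy]; field_simp; ring
    rw [h1, add_mul, mul_assoc, freq_mul_period hT.ne', hyw]; ring
  have h2 : Complex.exp (-(Complex.I * (ε * T : ℝ))) =
      Complex.exp (-(Complex.I * (ε' * T : ℝ))) *
        Complex.exp (Complex.I * (-(2 * Real.pi * w) : ℝ)) := by
    rw [hεT, ← Complex.exp_add, ← mul_one (Complex.exp (_ + _)),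
      ← Complex.exp_int_mul_two_pi_mul_I (-n), ← Complex.exp_add]
    congr 1; push_cast; ring
  have h3 : ‖Complex.exp (-(Complex.I * (ε' * T : ℝ)))‖ = 1 := by
    have := Complex.norm_exp_ofReal_mul_I (-(ε' * T))
    rw [← this]; congr 2; push_cast; ring
  rw [h2, ← mul_sub_one, norm_mul, h3, one_mul, Complex.norm_exp_I_mul_ofReal_sub_one,
    Real.norm_eq_abs, abs_mul, abs_two]
  have habs : |w| ≤ 1 / 2 := abs_le.2 ⟨by linarith [hmem.1], by linarith [hmem.2]⟩
  have habs2 : |-(2 * Real.pi * w) / 2| = Real.pi * |w| := by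
    have : -(2 * Real.pi * w) / 2 = -(Real.pi * w) := by ring
    rw [this, abs_neg, abs_mul, abs_of_pos Real.pi_pos]
  have h4 := Real.mul_abs_le_abs_sin (x := -(2 * Real.pi * w) / 2)
    (by rw [habs2]; nlinarith [Real.pi_pos])
  rw [habs2] at h4
  have h5 : 2 / Real.pi * (Real.pi * |w|) = 2 * |w| := by field_simp
  linarith

/-- An eigenvector of the monodromy operator gives a Floquet eigenstate. -/
theorem isFloquetEigenstate_of_monodromy [CompleteSpace E] {U : ℝ → E →L[ℂ] E}
    (hH : ∀ t, ((H t : E →L[ℂ] E) : E →ₗ[ℂ] E).IsSymmetric) (hper : ∀ t, H (t + T) = H t)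
    {t₀ : ℝ} (h0 : U t₀ = 1)
    (hU : ∀ t, HasDerivAt U (((-Complex.I) • H t) * U t) t)
    (hl : ∀ t, star (U t) * U t = 1) (hr : ∀ t, U t * star (U t) = 1) {ε : ℝ} {v : E}
    (hv : ‖v‖ = 1) (hM : U (t₀ + T) v = Complex.exp (-(Complex.I * (ε * T : ℝ))) • v) :
    IsFloquetEigenstate T H ε fun t => Complex.exp (Complex.I * (ε * t : ℝ)) • U t v := by
  have hnorm : ∀ s : ℝ, ‖Complex.exp (Complex.I * (s : ℝ))‖ = 1 := fun s => by
    rw [mul_comm]; exact Complex.norm_exp_ofReal_mul_I s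
  have hshift : ∀ t, U (t + T) = U t * U (t₀ + T) := by
    intro t
    have h1 := star_mul_eq_const (V := fun t => U (t + T)) hH hU (fun t => by
      have h2 := (hU (t + T)).comp_add_const t T
      rwa [hper] at h2) t₀ t
    rw [h0, star_one, one_mul] at h1
    rw [← h1, ← mul_assoc, hr, one_mul]
  refine ⟨fun t => ?_, fun t => ?_, fun t => ?_⟩
  · rw [hshift, mul_apply_eq_comp, hM, map_smul, smul_smul, ← Complex.exp_add]
    congr 2; push_cast; ring
  · rw [norm_smul, hnorm, one_mul, norm_apply_of_star_mul (hl t), hv]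
  · have hcancel : ∀ s : ℝ, Complex.exp (-(Complex.I * (ε * s : ℝ))) •
        Complex.exp (Complex.I * (ε * s : ℝ)) • U s v = U s v := by
      intro s
      rw [smul_smul, ← Complex.exp_add, neg_add_cancel, Complex.exp_zero, one_smul]
    simp only [hcancel]
    refine (hasDerivAt_clm_apply (hU t) (hasDerivAt_const t v)).congr_deriv ?_
    simp

end

/-! ### Trigonometric polynomials as approximate Floquet solutions -/

section

variable {E : Type*} [NormedAddCommGroup E] [InnerProductSpace ℂ E]
  {T α ζ : ℝ} {H : ℝ → E →L[ℂ] E} {Hm : ℤ → E →L[ℂ] E} {L : ℕ}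

/-- The trigonometric polynomial with coefficients `x l`, `l ∈ S`. -/
def trigPoly (T : ℝ) (S : Finset ℤ) (x : ℤ → E) (t : ℝ) : E := ∑ l ∈ S, phase T (-l) t • x l

theorem trigPoly_add_period (hT : 0 < T) (S : Finset ℤ) (x : ℤ → E) (t : ℝ) :
    trigPoly T S x (t + T) = trigPoly T S x t := by
  simp only [trigPoly, phase_add_period hT.ne']

theorem continuous_trigPoly (T : ℝ) (S : Finset ℤ) (x : ℤ → E) : Continuous (trigPoly T S x) := by
  unfold trigPoly; fun_prop

theorem hasDerivAt_trigPoly (T : ℝ) (S : Finset ℤ) (x : ℤ → E) (t : ℝ) :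
    HasDerivAt (trigPoly T S x)
      ((-Complex.I) • ∑ l ∈ S, phase T (-l) t • ((l * freq T : ℝ) : ℂ) • x l) t := by
  have h := HasDerivAt.fun_sum (u := S) fun l _ => (hasDerivAt_phase T (-l) t).smul_const (x l)
  refine h.congr_deriv ?_
  rw [Finset.smul_sum]
  refine Finset.sum_congr rfl fun l _ => ?_
  rw [smul_smul, smul_smul]
  congr 1; push_cast; ring

theorem hasSum_apply_trigPoly (hH : IsExpDecayHamiltonian T α ζ H Hm) (S : Finset ℤ) (x : ℤ → E)
    (t : ℝ) :
    HasSum (fun l => phase T (-l) t • ∑ k ∈ S, Hm (l - k) (x k)) (H t (trigPoly T S x t)) := by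
  have h1 : ∀ k ∈ S, HasSum (fun l => phase T (-l) t • Hm (l - k) (x k))
      (H t (phase T (-k) t • x k)) := by
    intro k _
    have h := (hH.hasSum_phase t).mapL (ContinuousLinearMap.apply ℂ E (phase T (-k) t • x k))
    rw [← (Equiv.subRight k).hasSum_iff] at h
    refine (congrArg (fun f => HasSum f _) ?_).mp h
    funext l
    simp only [Function.comp_apply, Equiv.subRight_apply, ContinuousLinearMap.apply_apply,
      smul_apply, map_smul, smul_smul]
    rw [← phase_add]
    congr 2; ring
  have h2 := hasSum_sum h1
  simp only [← Finset.smul_sum] at h2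
  rw [trigPoly, map_sum]
  exact h2

variable [FiniteDimensional ℂ E]

/-- By Parseval the mean of the squared norm is `1`. Starting the propagator at such a time keeps
the approximate eigenvector from being too short. -/
theorem exists_one_le_norm_trigPoly (hT : 0 < T) {S : Finset ℤ} {x : ℤ → E}
    (hx : ∑ l ∈ S, ‖x l‖ ^ 2 = 1) : ∃ t, 1 ≤ ‖trigPoly T S x t‖ := by
  have : CompleteSpace E := FiniteDimensional.complete ℂ E
  have hc := continuous_trigPoly T S x
  have h1 := hasSum_norm_fourierComponent_sq hT hc
  have h2 : HasSum (fun l => ‖fourierComponent T (trigPoly T S x) l‖ ^ 2) 1 := by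
    have hf : ∀ l, fourierComponent T (trigPoly T S x) l = if l ∈ S then x l else 0 :=
      fun l => fourierComponent_sum_phase_smul hT S x l
    have h3 : ∑ l ∈ S, ‖fourierComponent T (trigPoly T S x) l‖ ^ 2 = 1 := by
      rw [← hx]
      exact Finset.sum_congr rfl fun l hl => by rw [hf, if_pos hl]
    rw [← h3]
    exact hasSum_sum_of_ne_finset_zero fun l hl => by rw [hf, if_neg hl]; simp
  have h3 := h1.unique h2
  by_contra! hlt
  have h4 : ∫ t in (0 : ℝ)..T, ‖trigPoly T S x t‖ ^ 2 < ∫ t in (0 : ℝ)..T, (1 : ℝ) := by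
    have hlt' : ∀ t, ‖trigPoly T S x t‖ ^ 2 < 1 := fun t =>
      pow_lt_one₀ (norm_nonneg _) (hlt t) two_ne_zero
    exact intervalIntegral.integral_lt_integral_of_continuousOn_of_le_of_exists_lt hT
      (by fun_prop) (by fun_prop) (fun t _ => (hlt' t).le) ⟨0, Set.left_mem_Icc.2 hT.le, hlt' 0⟩
  have h5 : ∫ t in (0 : ℝ)..T, ‖trigPoly T S x t‖ ^ 2 = T := by
    have := congrArg (fun a => T * a) h3
    simpa [← mul_assoc, hT.ne'] using this
  rw [h5] at h4
  simp at h4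

/-- A trigonometric polynomial that almost solves the Floquet eigenvalue equation lies close to a
quasienergy. -/
theorem exists_quasienergy_near_of_residual (hH : IsExpDecayHamiltonian T α ζ H Hm) (hζ : 0 < ζ)
    (hT : 0 < T) {ε' ρ : ℝ} {S : Finset ℤ} {x : ℤ → E} (hx : ∑ l ∈ S, ‖x l‖ ^ 2 = 1)
    (hρ : ∀ t, ‖H t (trigPoly T S x t) - ∑ l ∈ S, phase T (-l) t •
      ((ε' + l * freq T : ℝ) : ℂ) • x l‖ ≤ ρ) :
    ∃ ε ∈ brillouinZone T, IsQuasienergy T H ε ∧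
      4 * |modOne ((ε - ε') / freq T)| ≤ ρ * T := by
  have : CompleteSpace E := FiniteDimensional.complete ℂ E
  obtain ⟨t₀, ht₀⟩ := exists_one_le_norm_trigPoly hT hx
  obtain ⟨U, h0, hU, hl, hr⟩ := exists_unitary_propagator (hH.continuous hζ)
    (hH.norm_apply_le hζ) hH.hermitian t₀
  set Ψ := trigPoly T S x with hΨ
  set p : ℝ → ℂ := fun t => Complex.exp (-(Complex.I * (ε' * t : ℝ))) with hp
  have hpnorm : ∀ t, ‖p t‖ = 1 := fun t => by
    have := Complex.norm_exp_ofReal_mul_I (-(ε' * t))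
    rw [← this]; simp only [hp]; congr 2; push_cast; ring
  have hpder : ∀ t, HasDerivAt p (p t * (-(Complex.I * ε'))) t := by
    intro t
    have h := (((hasDerivAt_id t).const_mul ε').ofReal_comp.const_mul Complex.I).neg.cexp
    refine h.congr_deriv ?_
    simp [hp]
  set r : ℝ → E := fun t => (Complex.I * p t) • (H t (Ψ t) - ∑ l ∈ S, phase T (-l) t •
      ((ε' + l * freq T : ℝ) : ℂ) • x l) with hrdef
  have hrle : ∀ t, ‖r t‖ ≤ ρ := by
    intro t
    rw [hrdef]
    simp only [norm_smul, norm_mul, Complex.norm_I, hpnorm, one_mul]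
    exact hρ t
  have hχ : ∀ t, HasDerivAt (fun t => p t • Ψ t)
      (((-Complex.I) • H t) (p t • Ψ t) + r t) t := by
    intro t
    refine ((hpder t).smul (hasDerivAt_trigPoly T S x t)).congr_deriv ?_
    have hsplit : ∑ l ∈ S, phase T (-l) t • ((ε' + l * freq T : ℝ) : ℂ) • x l =
        (ε' : ℂ) • Ψ t + ∑ l ∈ S, phase T (-l) t • ((l * freq T : ℝ) : ℂ) • x l := by
      rw [hΨ, trigPoly, Finset.smul_sum, ← Finset.sum_add_distrib]
      refine Finset.sum_congr rfl fun l _ => ?_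
      push_cast
      module
    simp only [hrdef, hsplit, smul_apply, map_smul]
    module
  have hdiff := norm_propagator_sub_le hH.hermitian h0 hU hl hr hχ hrle hT.le
  set μ := Complex.exp (-(Complex.I * (ε' * T : ℝ))) with hμ
  have hshift : p (t₀ + T) • Ψ (t₀ + T) = μ • p t₀ • Ψ t₀ := by
    rw [hΨ, trigPoly_add_period hT, smul_smul, hp, hμ]
    simp only
    rw [← Complex.exp_add]
    congr 2; push_cast; ring
  rw [hshift] at hdiff
  have hχ1 : 1 ≤ ‖p t₀ • Ψ t₀‖ := by rw [norm_smul, hpnorm, one_mul]; exact ht₀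
  have hρT : 0 ≤ ρ * T := (norm_nonneg _).trans hdiff
  -- The monodromy operator is unitary, hence normal, and moves the starting vector to within `ρT`
  -- of `μ` times itself.
  obtain ⟨z, hz, hzle⟩ := exists_hasEigenvalue_near (N := (U (t₀ + T) : E →ₗ[ℂ] E))
    (N' := ((star (U (t₀ + T)) : E →L[ℂ] E) : E →ₗ[ℂ] E)) (μ := μ) (η := ρ * T)
    (v := p t₀ • Ψ t₀)
    (fun u v => (ContinuousLinearMap.adjoint_inner_right (U (t₀ + T)) u v).symm)
    (fun v => by
      have h1 : U (t₀ + T) (star (U (t₀ + T)) v) = v :=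
        congrArg (fun A : E →L[ℂ] E => A v) (hr (t₀ + T))
      have h2 : star (U (t₀ + T)) (U (t₀ + T) v) = v :=
        congrArg (fun A : E →L[ℂ] E => A v) (hl (t₀ + T))
      exact h1.trans h2.symm)
    (norm_pos_iff.1 (by linarith))
    (hdiff.trans (le_mul_of_one_le_right hρT hχ1))
  obtain ⟨w, hw⟩ := hz.exists_hasEigenvector
  have hw1 : U (t₀ + T) w = z • w := hw.apply_eq_smul
  have hwn : ‖w‖ ≠ 0 := norm_ne_zero_iff.2 hw.2
  have hznorm : ‖z‖ = 1 := by
    have h1 := norm_apply_of_star_mul (hl (t₀ + T)) w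
    rw [hw1, norm_smul] at h1
    exact mul_right_cancel₀ hwn (h1.trans (one_mul _).symm)
  obtain ⟨ε, hε, hεz⟩ := exists_mem_brillouinZone_exp_eq hT hznorm
  refine ⟨ε, hε, ⟨_, isFloquetEigenstate_of_monodromy (v := ((‖w‖⁻¹ : ℝ) : ℂ) • w) hH.hermitian
    (hH.apply_add_period hT) h0 hU hl hr ?_ ?_⟩, ?_⟩
  · rw [norm_smul, Complex.norm_real, norm_inv, norm_norm, inv_mul_cancel₀ hwn]
  · rw [map_smul, hw1, hεz, smul_comm]
  · refine (abs_modOne_le hT).trans ?_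
    rw [hεz]
    exact hzle

/-- Every eigenvalue of the truncated Floquet Hamiltonian in the first two Brillouin zones is
close, modulo `ω`, to a quasienergy. -/
theorem exists_quasienergy_near (hH : IsExpDecayHamiltonian T α ζ H Hm) (hζ : 0 < ζ)
    (hT : 0 < T) (hα : 0 ≤ α) {δ : ℝ} (hδ : 0 < δ) (hδ1 : δ < 1)
    (hL : cutoffConst (1 / (4 * ζ)) * (2 * Real.pi * (α / freq T) + Real.log (1 / δ)) ≤ L)
    {ε' : ℝ} (hε' : |ε'| ≤ freq T)
    (hev : Module.End.HasEigenvalue (truncFloquetHamiltonian T Hm L) (ε' : ℂ)) :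
    ∃ ε ∈ brillouinZone T, IsQuasienergy T H ε ∧
      |modOne ((ε - ε') / freq T)| ≤ δ := by
  have hω := freq_pos hT
  set s := 1 / (4 * ζ) with hsdef
  have hs : 0 < s := by positivity
  set β := α / freq T with hβdef
  have hβ : 0 ≤ β := by positivity
  have hR := tsum_exp_neg_half hs
  set R := coth (s / 4) with hRdef
  set P := coth s * Real.exp (s * (1 + β * coth s)) with hPdef
  have hP0 : 0 ≤ P := mul_nonneg (zero_le_one.trans (one_le_coth hs)) (Real.exp_pos _).le
  obtain ⟨b1, -⟩ := cutoff_bounds hs hβ hδ hδ1 hL (decay_prefactor_le hs hβ le_rfl) hP0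
  set e0 := Real.exp (-(s / 2 * L)) with he0
  set W := Finset.Ioc (-(L : ℤ)) (L : ℤ) with hW
  obtain ⟨Ψ', hΨ'⟩ := hev.exists_hasEigenvector
  set Ψ : TruncSambe E L := ((‖Ψ'‖⁻¹ : ℝ) : ℂ) • Ψ' with hΨ
  have hΨ1 : ‖Ψ‖ = 1 := by
    rw [hΨ, norm_smul, Complex.norm_real, norm_inv, norm_norm,
      inv_mul_cancel₀ (norm_ne_zero_iff.2 hΨ'.2)]
  have hΨeq : truncFloquetHamiltonian T Hm L Ψ = (ε' : ℂ) • Ψ := by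
    rw [hΨ, map_smul, hΨ'.apply_eq_smul, smul_comm]
  set x := extendZero Ψ with hx
  have hxW : ∑ l ∈ W, ‖x l‖ ^ 2 = 1 := by
    have : ∑ l, ‖Ψ l‖ ^ 2 = ∑ l ∈ W, ‖x l‖ ^ 2 := by
      rw [← Finset.sum_coe_sort W]
      refine Finset.sum_congr rfl fun k _ => ?_
      have hk := k.2
      simp [hx, extendZero, hk]
    rw [← this, ← PiLp.norm_sq_eq_of_L2, hΨ1, one_pow]
  have hx0 : ∀ l ∉ W, x l = 0 := fun l hl => dif_neg hl
  have hxsum : HasSum (fun l => ‖x l‖ ^ 2) 1 := by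
    rw [← hxW]
    exact hasSum_sum_of_ne_finset_zero fun l hl => by rw [hx0 l hl]; simp
  set G : ℤ → E := fun l => ∑ k ∈ W, Hm (l - k) (x k) with hG
  have hGsum : ∀ l, HasSum (fun m => Hm m (x (l - m))) (G l) := by
    intro l
    have h := hasSum_extendZero Hm Ψ l
    have : ∑ l' : TruncIndex L, Hm (l - (l' : ℤ)) (Ψ l') = G l := by
      rw [hG]
      simp only
      rw [← Finset.sum_coe_sort W]
      refine Finset.sum_congr rfl fun k _ => ?_
      have hk := k.2
      simp [hx, extendZero, hk]
    rwa [this] at h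
  have hGW : ∀ l ∈ W, G l = ((ε' + l * freq T : ℝ) : ℂ) • x l := by
    intro l hl
    have h1 := congrArg (fun Φ : TruncSambe E L => Φ ⟨l, hl⟩) hΨeq
    simp only [truncFloquetHamiltonian_apply, PiLp.smul_apply] at h1
    have h2 : x l = Ψ ⟨l, hl⟩ := dif_pos hl
    rw [(hGsum l).unique (hasSum_extendZero Hm Ψ l), sub_eq_iff_eq_add.1 h1, h2, ← add_smul]
    push_cast
    rfl
  -- `κ = 1` because `ε'` ranges over `|ε'| ≤ ω`, twice the Brillouin zone.
  have hweak : IsWeaklyCoupled s β 1 fun l => ‖x l‖ := by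
    refine isWeaklyCoupled_of_hasSum hH hζ hT hxsum hα (ε := ε') (by rwa [one_mul]) fun l => ?_
    by_cases hl : l ∈ W
    · right; rw [← hGW l hl]; exact hGsum l
    · left; exact hx0 l hl
  have hGle : ∀ l ∉ W, ‖G l‖ ≤ α * P * e0 * Real.exp (-(s / 2 * |(l : ℝ)|)) := by
    intro l hl
    have h1 := norm_le_tsum_of_hasSum_component hH (hGsum l) (hweak.summable_convolution hs l)
    have h2 := mul_le_mul_of_nonneg_left (hweak.convolution_le hs hβ l) hα
    refine (h1.trans h2).trans ?_
    rw [← hPdef, ← mul_assoc, mul_assoc (α * P)]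
    exact mul_le_mul_of_nonneg_left (exp_neg_le_of_le_abs hs (le_abs_of_notMem_Ioc hl))
      (mul_nonneg hα hP0)
  -- Inside the window the eigenvalue equation makes every coefficient vanish; only leakage outside
  -- it remains.
  have hres : ∀ t, ‖H t (trigPoly T W x t) - ∑ l ∈ W, phase T (-l) t •
      ((ε' + l * freq T : ℝ) : ℂ) • x l‖ ≤ α * P * e0 * R := by
    intro t
    have h1 := hasSum_apply_trigPoly hH W x t
    have h2 : HasSum (fun l => phase T (-l) t • ((ε' + l * freq T : ℝ) : ℂ) • x l)
        (∑ l ∈ W, phase T (-l) t • ((ε' + l * freq T : ℝ) : ℂ) • x l) :=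
      hasSum_sum_of_ne_finset_zero fun l hl => by rw [hx0 l hl]; simp
    refine (h1.sub h2).norm_le_of_bounded (hR.mul_left _) fun l => ?_
    rw [← smul_sub, norm_smul, norm_phase, one_mul]
    by_cases hl : l ∈ W
    · change ‖G l - _‖ ≤ _
      rw [hGW l hl, sub_self, norm_zero]
      positivity
    · rw [hx0 l hl, smul_zero, sub_zero]
      exact hGle l hl
  obtain ⟨ε, hε, hq, hle⟩ := exists_quasienergy_near_of_residual hH hζ hT hxW hres
  refine ⟨ε, hε, hq, ?_⟩
  have h1 : α * P * e0 * R * T = 2 * Real.pi * (β * P * R * e0) := by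
    have : α = β * freq T := by rw [hβdef]; field_simp
    rw [this, ← freq_mul_period hT.ne']; ring
  rw [h1] at hle
  have h2 : 2 * Real.pi * (β * P * R * e0) ≤ 2 * Real.pi * (δ / 4) := by
    have := Real.pi_pos
    gcongr
  nlinarith [Real.pi_lt_four]

end

end Floquet

end

theorem theoremE1 (ζ : ℝ) (hζ : 0 < ζ) :
    -- exponential tails of the Floquet eigenstates
    (∀ (E : Type*) [NormedAddCommGroup E] [InnerProductSpace ℂ E] [FiniteDimensional ℂ E]
      (T α : ℝ), 0 < T → 0 < α →
      ∀ (H : ℝ → E →L[ℂ] E) (Hm : ℤ → E →L[ℂ] E), Floquet.IsExpDecayHamiltonian T α ζ H Hm →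
      ∀ (ε : ℝ) (φ : ℝ → E), Floquet.IsFloquetEigenstate T H ε φ →
      ε ∈ Floquet.brillouinZone T →
      ∀ l : ℤ, ‖Floquet.fourierComponent T φ l‖ ≤
        Real.exp (-((|(l : ℝ)| - 1 / 2) / (4 * ζ)) +
          Floquet.coth (1 / (4 * ζ)) / (8 * Real.pi * ζ) * (α * T))) ∧
    -- accuracy of the truncated Sambe space with a cutoff of order `α T + log (1 / δ)`
    (∃ C : ℝ, 0 < C ∧
      ∀ (E : Type*) [NormedAddCommGroup E] [InnerProductSpace ℂ E] [FiniteDimensional ℂ E]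
      (T α : ℝ), 0 < T → 0 < α →
      ∀ (H : ℝ → E →L[ℂ] E) (Hm : ℤ → E →L[ℂ] E), Floquet.IsExpDecayHamiltonian T α ζ H Hm →
      ∀ δ : ℝ, 0 < δ → δ < 1 →
      ∀ L : ℕ, C * (α * T + Real.log (1 / δ)) ≤ (L : ℝ) →
        (∀ ε ∈ Floquet.brillouinZone T, Floquet.IsQuasienergy T H ε →
          ∃ ε' : ℝ,
            Module.End.HasEigenvalue (Floquet.truncFloquetHamiltonian T Hm L) (ε' : ℂ) ∧
            |ε' - ε| / Floquet.freq T ≤ δ) ∧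
        (∀ ε' ∈ Set.Ico (-Floquet.freq T) (Floquet.freq T),
          Module.End.HasEigenvalue (Floquet.truncFloquetHamiltonian T Hm L) (ε' : ℂ) →
          ∃ ε ∈ Floquet.brillouinZone T, Floquet.IsQuasienergy T H ε ∧
            |Floquet.modOne ((ε - ε') / Floquet.freq T)| ≤ δ)) := by
  have hs : 0 < 1 / (4 * ζ) := by positivity
  refine ⟨?_, Floquet.cutoffConst (1 / (4 * ζ)), Floquet.cutoffConst_pos hs, ?_⟩
  · intro E _ _ _ T α hT hα H Hm hH ε φ hφ hε l
    exact hφ.norm_fourierComponent_le hH hζ hT hα.le hε l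
  · intro E _ _ _ T α hT hα H Hm hH δ hδ hδ1 L hL
    have hlog : 0 < Real.log (1 / δ) := Real.log_pos (by rw [lt_div_iff₀ hδ]; linarith)
    -- Strict positivity of the lower bound on `L` excludes the empty window.
    have hL1 : 1 ≤ L := by
      have h1 : (0 : ℝ) < L := lt_of_lt_of_le
        (mul_pos (Floquet.cutoffConst_pos hs) (add_pos (mul_pos hα hT) hlog)) hL
      exact_mod_cast h1
    have hαT : α * T = 2 * Real.pi * (α / Floquet.freq T) := by
      unfold Floquet.freq; field_simp
    rw [hαT] at hL
    constructor
    · rintro ε hε ⟨φ, hφ⟩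
      exact hφ.exists_hasEigenvalue hH hζ hT hα.le hε hL1 hδ hδ1 hL
    · intro ε' hε' hev
      exact Floquet.exists_quasienergy_near hH hζ hT hα.le hδ hδ1 hL
        (abs_le.2 ⟨hε'.1, hε'.2.le⟩) hev
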